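/- Let $k$ be a field of characteristic $0$, let $R$ be a commutative $k$-algebra, let $L$ be a Lie–Rinehart algebra over $(k,R)$ and let $A\subseteq L$ be a Lie–Rinehart subalgebra (an $R$-submodule closed under the bracket). For example, a Lie algebroid $L$ over a manifold $M$ with a Lie subalgebroid $A$ gives such a pair, with $R=C^\infty(M)$ and with the modules of sections $\Gamma(A)\subseteq\Gamma(L)$. By an $A$-module we mean a left module over the universal enveloping algebra $\mathcal U(A)$ of the Lie–Rinehart algebra $A$, equivalently an $R$-module with a flat $A$-connection. All tensor products are over $R$. Let $D^1=\mathcal U(L)/\mathcal U(L)A$, where $\mathcal U(L)$ is regarded as a left $R$-module, with the comultiplication $\Delta:D^1\to D^1\otimes D^1$ induced by the comultiplication of $\mathcal U(L)$, $\Delta(f)=f\otimes 1$ for $f\in R$ and $\Delta(l)=l\otimes 1+1\otimes l$ for $l\in L$, and with the $A$-action by left multiplication. Let $D^n=(D^1)^{\otimes n}$, $D^0=R$, and let $D^\bullet=\bigoplus_{n\ge 0}D^n$ be the tensor algebra, with the diagonal $A$-action (by derivations) and the differential $$d(p_1\otimes\cdots\otimes p_n)=1\otimes p_1\otimes\cdots\otimes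 p_n+\sum_{i=1}^n(-1)^i\,p_1\otimes\cdots\otimes\Delta p_i\otimes\cdots\otimes p_n+(-1)^{n+1}p_1\otimes\cdots\otimes p_n\otimes 1 .$$ Let $L(D^1)\subseteq D^\bullet$ be the graded free Lie algebra generated over $R$ by $D^1$ in degree $1$, i.e. the smallest $R$-submodule that contains $D^1$ and is closed under $[u,v]=u\otimes v-(-1)^{ij}v\otimes u$ for $u\in D^i$, $v\in D^j$; it is stable under $d$ and under the action of $A$. Let $S^\bullet(L(D^1))$ be its graded symmetric algebra over $R$, i.e. the quotient of the tensor algebra of $L(D^1)$ by the relations $x\odot y=(-1)^{ij}y\odot x$ for $x,y$ homogeneous of degrees $i,j$, graded by total degree, on which the differential $d$ acts as the graded derivation, and each $a\in A$ acts as the derivation, extending those on $L(D^1)$ (on $R=S^0(L(D^1))$, $d$ is zero and $a$ acts by the anchor). Then there is a unique $R$-linear map $I:S^\bullet(L(D^1))\to D^\bullet$ such that, for all $n\ge 0$ and all homogeneous $z_1,\dots,z_n\in L(D^1)$, $$I(z_1\odot\cdots\odot z_n)=\frac1{n!}\sum_{\sigma\in S_n}\operatorname{sgn}(\sigma;z_1,\dots,z_n)\,z_{\sigma(1)}\otimes\cdots\otimes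 z_{\sigma(n)},$$ where the Koszul sign $\operatorname{sgn}(\sigma;z_1,\dots,z_n)$ is the product of the signs $(-1)^{|z_{\sigma(i)}|\,|z_{\sigma(j)}|}$ over all $i<j$ with $\sigma(i)>\sigma(j)$. This map $I$ is an isomorphism of cochain complexes of $A$-modules from $(S^\bullet(L(D^1)),d)$ to $(D^\bullet,d)$. -/

import Mathlib

open scoped TensorProduct

namespace LiePair

set_option linter.unusedSectionVars false

universe u v w v'

section Enveloping

variable (k : Type u) (R : Type v) (L : Type w) [Field k] [CommRing R] [Algebra k R]
  [LieRing L] [LieAlgebra k L] [Module R L] [LieRingModule L R] [LieRinehartRing R L]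
  [LieRinehartAlgebra k R L]

/-- The defining relations of the universal enveloping algebra of a Lie-Rinehart algebra `(R, L)`.
The first family presents the enveloping algebra of the Lie algebra `R ⊕ L` with bracket
`[f + X, g + Y] = (X g - Y f) + [X, Y]`; the other two are `f · (g + Y) = fg + fY` and
the identification of the unit of `R` with the unit of the algebra. -/
inductive EnvRel : TensorAlgebra k (R × L) → TensorAlgebra k (R × L) → Prop
  | lie (a b : R × L) :
      EnvRel (TensorAlgebra.ι k a * TensorAlgebra.ι k b - TensorAlgebra.ι k b * TensorAlgebra.ι k a)
        (TensorAlgebra.ι k (⁅a.2, b.1⁆ - ⁅b.2, a.1⁆, ⁅a.2, b.2⁆))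
  | smul (f : R) (a : R × L) :
      EnvRel (TensorAlgebra.ι k (f, 0) * TensorAlgebra.ι k a) (TensorAlgebra.ι k (f • a))
  | one : EnvRel (TensorAlgebra.ι k (1, 0)) 1

/-- The universal enveloping algebra `U(L)` of the Lie-Rinehart algebra `(R, L)` over `k`. -/
def Env : Type (max u v w) := RingQuot (EnvRel k R L)

noncomputable instance : Ring (Env k R L) := inferInstanceAs (Ring (RingQuot (EnvRel k R L)))

noncomputable instance : Algebra k (Env k R L) :=
  inferInstanceAs (Algebra k (RingQuot (EnvRel k R L)))

namespace Env

/-- The canonical algebra map from the tensor algebra of `R ⊕ L`. -/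
noncomputable def proj : TensorAlgebra k (R × L) →ₐ[k] Env k R L :=
  RingQuot.mkAlgHom k (EnvRel k R L)

theorem proj_surjective : Function.Surjective (proj k R L) :=
  RingQuot.mkAlgHom_surjective k (EnvRel k R L)

/-- The canonical map `R ⊕ L → U(L)`. -/
noncomputable def gen : R × L →ₗ[k] Env k R L :=
  (proj k R L).toLinearMap.comp (TensorAlgebra.ι k)

theorem gen_lie (a b : R × L) : gen k R L a * gen k R L b - gen k R L b * gen k R L a =
    gen k R L (⁅a.2, b.1⁆ - ⁅b.2, a.1⁆, ⁅a.2, b.2⁆) := by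
  have h : proj k R L _ = proj k R L _ := RingQuot.mkAlgHom_rel k (EnvRel.lie a b)
  rw [map_sub, map_mul, map_mul] at h
  exact h

theorem gen_smul (f : R) (a : R × L) :
    gen k R L (f, 0) * gen k R L a = gen k R L (f • a) := by
  have h : proj k R L _ = proj k R L _ := RingQuot.mkAlgHom_rel k (EnvRel.smul f a)
  rw [map_mul] at h
  exact h

theorem gen_one : gen k R L (1, 0) = 1 := by
  have h : proj k R L _ = proj k R L _ := RingQuot.mkAlgHom_rel k EnvRel.one
  rw [map_one] at h
  exact h

/-- The canonical algebra homomorphism `R → U(L)`. -/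
noncomputable def ofRing : R →ₐ[k] Env k R L :=
  AlgHom.ofLinearMap ((gen k R L).comp (LinearMap.inl k R L)) (gen_one k R L) (fun f g => by
    have := gen_smul k R L f (g, 0)
    simpa using this.symm)

/-- The canonical map `L → U(L)`. -/
noncomputable def ofLie : L →ₗ[k] Env k R L := (gen k R L).comp (LinearMap.inr k R L)

theorem gen_eq (a : R × L) : gen k R L a = ofRing k R L a.1 + ofLie k R L a.2 := by
  change _ = gen k R L (a.1, 0) + gen k R L (0, a.2)
  rw [← map_add]; simp

theorem ofLie_lie (x y : L) : ofLie k R L ⁅x, y⁆ =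
    ofLie k R L x * ofLie k R L y - ofLie k R L y * ofLie k R L x := by
  have h := gen_lie k R L (0, x) (0, y)
  simp only [lie_zero, sub_zero] at h
  exact h.symm

theorem ofLie_smul (f : R) (x : L) :
    ofLie k R L (f • x) = ofRing k R L f * ofLie k R L x := by
  have h := gen_smul k R L f (0, x)
  simp only [Prod.smul_mk, smul_zero] at h
  exact h.symm

theorem ofLie_mul_ofRing (x : L) (f : R) : ofLie k R L x * ofRing k R L f =
    ofRing k R L f * ofLie k R L x + ofRing k R L ⁅x, f⁆ := by
  have h := gen_lie k R L (0, x) (f, 0)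
  simp only [lie_zero, sub_zero] at h
  rw [← sub_eq_iff_eq_add']
  exact h

theorem induction {P : Env k R L → Prop} (ring : ∀ f, P (ofRing k R L f))
    (lie : ∀ x, P (ofLie k R L x)) (mul : ∀ a b, P a → P b → P (a * b))
    (add : ∀ a b, P a → P b → P (a + b)) (u : Env k R L) : P u := by
  obtain ⟨t, rfl⟩ := proj_surjective k R L u
  induction t using TensorAlgebra.induction with
  | algebraMap c =>
    rw [AlgHom.commutes, ← AlgHom.commutes (ofRing k R L)]
    exact ring _
  | ι a =>
    change P (gen k R L a)
    rw [gen_eq]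
    exact add _ _ (ring _) (lie _)
  | mul a b ha hb => rw [map_mul]; exact mul _ _ ha hb
  | add a b ha hb => rw [map_add]; exact add _ _ ha hb

/-- `U(L)` is regarded as a left `R`-module. -/
noncomputable instance : Module R (Env k R L) := Module.compHom _ (ofRing k R L).toRingHom

theorem smul_def (f : R) (u : Env k R L) : f • u = ofRing k R L f * u := rfl

instance : IsScalarTower R (Env k R L) (Env k R L) :=
  ⟨fun f u v => by simp [smul_def, mul_assoc]⟩

instance : IsScalarTower k R (Env k R L) :=
  ⟨fun c f u => by simp [smul_def]⟩

end Env

end Enveloping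

section Connections

/-- A module over the Lie-Rinehart algebra `(R, L)`: an `R`-module `E` with a flat `L`-connection.
This is the same thing as a module over `U(L)`; see `FlatConnection.toAlgHom`. -/
structure FlatConnection (k : Type u) (R : Type v) (L : Type w) [Field k] [CommRing R]
    [Algebra k R] [LieRing L] [LieAlgebra k L] [Module R L] [LieRingModule L R]
    (E : Type*) [AddCommGroup E] [Module k E] [Module R E] where
  /-- The covariant derivative `∇ₓ : E → E`. -/
  nabla : L →ₗ[k] Module.End k E
  map_lie (x y : L) (e : E) : nabla ⁅x, y⁆ e = nabla x (nabla y e) - nabla y (nabla x e)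
  map_smul (f : R) (x : L) (e : E) : nabla (f • x) e = f • nabla x e
  leibniz (x : L) (f : R) (e : E) : nabla x (f • e) = f • nabla x e + ⁅x, f⁆ • e

variable {k : Type u} {R : Type v} {L : Type w} [Field k] [CommRing R] [Algebra k R]
  [LieRing L] [LieAlgebra k L] [Module R L] [LieRingModule L R] [LieRinehartRing R L]
  [LieRinehartAlgebra k R L]
  {E : Type*} [AddCommGroup E] [Module k E] [Module R E] [IsScalarTower k R E]
  {F : Type*} [AddCommGroup F] [Module k F] [Module R F] [IsScalarTower k R F]

namespace FlatConnection

/-- Additive maps satisfying the axioms of a flat connection are automatically `k`-linear. -/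
def ofAddHom (D : L → E →+ E) (add : ∀ x y e, D (x + y) e = D x e + D y e)
    (lie : ∀ x y e, D ⁅x, y⁆ e = D x (D y e) - D y (D x e))
    (smul : ∀ (f : R) x e, D (f • x) e = f • D x e)
    (leibniz : ∀ x (f : R) e, D x (f • e) = f • D x e + ⁅x, f⁆ • e) :
    FlatConnection k R L E where
  nabla :=
    { toFun := fun x =>
        { toFun := D x
          map_add' := map_add (D x)
          map_smul' := fun c e => by
            have h : ⁅x, algebraMap k R c⁆ = 0 := by
              have := LieRinehartAlgebra.anchor_apply (R := k) x (algebraMap k R c)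
              rw [← this, Derivation.map_algebraMap]
            have := leibniz x (algebraMap k R c) e
            rw [h, zero_smul, add_zero, algebraMap_smul, algebraMap_smul] at this
            exact this }
      map_add' := fun x y => LinearMap.ext (add x y)
      map_smul' := fun c x => LinearMap.ext fun e => by
        have := smul (algebraMap k R c) x e
        rw [algebraMap_smul, algebraMap_smul] at this
        exact this }
  map_lie := lie
  map_smul := smul
  leibniz := leibniz

/-- The action of `U(L)` on a module with a flat connection. -/
noncomputable def toAlgHom (C : FlatConnection k R L E) : Env k R L →ₐ[k] Module.End k E :=
  RingQuot.liftAlgHom k ⟨TensorAlgebra.lift k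
    ((Algebra.lsmul k k E : R →ₐ[k] Module.End k E).toLinearMap.coprod C.nabla), by
      intro a b h
      induction h with
      | lie a b =>
        ext e
        simp [C.map_lie, C.leibniz, smul_smul, mul_comm]
        abel
      | smul f a =>
        ext e
        simp [C.map_smul, smul_smul]
      | one => ext e; simp⟩

theorem toAlgHom_ofRing (C : FlatConnection k R L E) (f : R) (e : E) :
    C.toAlgHom (Env.ofRing k R L f) e = f • e := by
  have : C.toAlgHom (Env.ofRing k R L f) = _ :=
    RingQuot.liftAlgHom_mkAlgHom_apply k _ _ (TensorAlgebra.ι k (f, 0))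
  rw [this]; simp

theorem toAlgHom_ofLie (C : FlatConnection k R L E) (x : L) (e : E) :
    C.toAlgHom (Env.ofLie k R L x) e = C.nabla x e := by
  have : C.toAlgHom (Env.ofLie k R L x) = _ :=
    RingQuot.liftAlgHom_mkAlgHom_apply k _ _ (TensorAlgebra.ι k (0, x))
  rw [this]; simp

theorem toAlgHom_map (C : FlatConnection k R L E) (C' : FlatConnection k R L F) (φ : E →ₗ[R] F)
    (h : ∀ x e, φ (C.nabla x e) = C'.nabla x (φ e)) (u : Env k R L) :
    ∀ e, φ (C.toAlgHom u e) = C'.toAlgHom u (φ e) := by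
  induction u using Env.induction with
  | ring f => intro e; simp [toAlgHom_ofRing]
  | lie x => intro e; simp [toAlgHom_ofLie, h]
  | mul a b ha hb => intro e; simp [ha, hb]
  | add a b ha hb => intro e; simp [ha, hb]

/-- The module over `U(L)` given by a flat connection, as an object of the category of
`U(L)`-modules. -/
noncomputable def toModuleCat (C : FlatConnection k R L E) : ModuleCat (Env k R L) :=
  letI : Module (Env k R L) E := Module.compHom E C.toAlgHom.toRingHom
  ModuleCat.of (Env k R L) E

/-- An `R`-linear map that commutes with the connections, as a morphism of `U(L)`-modules. -/
noncomputable def homOf {E F : Type v'} [AddCommGroup E] [Module k E] [Module R E]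
    [IsScalarTower k R E] [AddCommGroup F] [Module k F] [Module R F] [IsScalarTower k R F]
    (C : FlatConnection k R L E) (C' : FlatConnection k R L F) (φ : E →ₗ[R] F)
    (h : ∀ x e, φ (C.nabla x e) = C'.nabla x (φ e)) : C.toModuleCat ⟶ C'.toModuleCat :=
  letI : Module (Env k R L) E := Module.compHom E C.toAlgHom.toRingHom
  letI : Module (Env k R L) F := Module.compHom F C'.toAlgHom.toRingHom
  ModuleCat.ofHom (X := E) (Y := F)
    { toFun := φ
      map_add' := map_add φ
      map_smul' := fun u e => toAlgHom_map C C' φ h u e }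

/-- Restriction of a flat connection to an invariant submodule. -/
def restrict (C : FlatConnection k R L E) (N : Submodule R E)
    (h : ∀ x, ∀ e ∈ N, C.nabla x e ∈ N) : FlatConnection k R L N :=
  ofAddHom (fun x => AddMonoidHom.mk' (fun e => ⟨C.nabla x e, h x e e.2⟩)
      (fun a b => Subtype.ext (map_add (C.nabla x) _ _)))
    (fun x y e => Subtype.ext (by simp))
    (fun x y e => Subtype.ext (C.map_lie x y e))
    (fun f x e => Subtype.ext (C.map_smul f x e))
    (fun x f e => Subtype.ext (C.leibniz x f e))

/-- Restriction of an `L`-module to a Lie-Rinehart subalgebra `A` of `L`. -/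
def restrictTo (C : FlatConnection k R L E) (A : LieRinehartSubalgebra R L) :
    FlatConnection k R A E :=
  ofAddHom (fun x => (C.nabla x).toAddMonoidHom)
    (fun x y e => by simp) (fun x y e => C.map_lie x y e) (fun f x e => C.map_smul f x e)
    (fun x f e => C.leibniz x f e)

/-- A module over `U(L)` carries a flat connection. -/
noncomputable def ofModule (M : Type*) [AddCommGroup M] [Module (Env k R L) M] [Module k M]
    [Module R M] [IsScalarTower k R M] [IsScalarTower R (Env k R L) M] :
    FlatConnection k R L M :=
  ofAddHom (fun x => AddMonoidHom.mk' (fun e => Env.ofLie k R L x • e) (fun a b => smul_add _ a b))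
    (fun x y e => by simp [add_smul])
    (fun x y e => by simp [Env.ofLie_lie, sub_smul, mul_smul])
    (fun f x e => by simp [Env.ofLie_smul, ← Env.smul_def])
    (fun x f e => by
      have h (g : R) (m : M) : g • m = Env.ofRing k R L g • m := by
        rw [← one_smul (Env k R L) m, ← smul_assoc, Env.smul_def, mul_one, one_smul]
      simp only [AddMonoidHom.mk'_apply, h, ← mul_smul, ← add_smul,
        Env.ofLie_mul_ofRing])

theorem ofModule_nabla (M : Type*) [AddCommGroup M] [Module (Env k R L) M] [Module k M]
    [Module R M] [IsScalarTower k R M] [IsScalarTower R (Env k R L) M] (x : L) (m : M) :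
    (ofModule (k := k) (R := R) (L := L) M).nabla x m = Env.ofLie k R L x • m := rfl

/-- The additive map `e ⊗ e' ↦ ∇ₓ e ⊗ e' + e ⊗ ∇ₓ e'`. -/
noncomputable def tensorAux (C : FlatConnection k R L E) (C' : FlatConnection k R L F) (x : L) :
    E ⊗[R] F →+ E ⊗[R] F :=
  TensorProduct.liftAddHom
    (AddMonoidHom.mk' (fun e => AddMonoidHom.mk'
        (fun e' => C.nabla x e ⊗ₜ[R] e' + e ⊗ₜ[R] C'.nabla x e')
        (fun a b => by simp [TensorProduct.tmul_add]; abel))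
      (fun a b => by ext e'; simp [TensorProduct.add_tmul]; abel))
    (fun f e e' => by
      simp only [AddMonoidHom.mk'_apply, C.leibniz, C'.leibniz, TensorProduct.add_tmul,
        TensorProduct.tmul_add, TensorProduct.smul_tmul]
      abel)

theorem tensorAux_tmul (C : FlatConnection k R L E) (C' : FlatConnection k R L F) (x : L)
    (e : E) (e' : F) : tensorAux C C' x (e ⊗ₜ[R] e') =
      C.nabla x e ⊗ₜ[R] e' + e ⊗ₜ[R] C'.nabla x e' := rfl

/-- The tensor product (over `R`) of two modules over `(R, L)`:
`∇ₓ (e ⊗ e') = ∇ₓ e ⊗ e' + e ⊗ ∇ₓ e'`. -/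
noncomputable def tensor (C : FlatConnection k R L E) (C' : FlatConnection k R L F) :
    FlatConnection k R L (E ⊗[R] F) :=
  ofAddHom (tensorAux C C')
    (fun x y t => by
      induction t with
      | zero => simp
      | tmul e e' => simp [tensorAux_tmul, TensorProduct.add_tmul, TensorProduct.tmul_add]; abel
      | add a b ha hb => simp only [map_add, ha, hb]; abel)
    (fun x y t => by
      induction t with
      | zero => simp
      | tmul e e' =>
        simp [tensorAux_tmul, TensorProduct.sub_tmul, TensorProduct.tmul_sub, C.map_lie, C'.map_lie]; abel
      | add a b ha hb => simp only [map_add, ha, hb]; abel)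
    (fun f x t => by
      induction t with
      | zero => simp
      | tmul e e' => simp [tensorAux_tmul, C.map_smul, C'.map_smul, TensorProduct.smul_tmul']
      | add a b ha hb => simp only [map_add, smul_add, ha, hb])
    (fun x f t => by
      induction t with
      | zero => simp
      | tmul e e' =>
        simp [tensorAux_tmul, C.leibniz, TensorProduct.smul_tmul', TensorProduct.add_tmul]; abel
      | add a b ha hb => simp only [map_add, smul_add, ha, hb]; abel)

theorem tensor_nabla_tmul (C : FlatConnection k R L E) (C' : FlatConnection k R L F) (x : L)
    (e : E) (e' : F) : (C.tensor C').nabla x (e ⊗ₜ[R] e') =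
      C.nabla x e ⊗ₜ[R] e' + e ⊗ₜ[R] C'.nabla x e' := rfl

end FlatConnection

end Connections

section Coalgebra

variable (k : Type u) {R : Type v} {L : Type w} [Field k] [CommRing R] [Algebra k R]
  [LieRing L] [LieAlgebra k L] [Module R L] [LieRingModule L R] [LieRinehartRing R L]
  [LieRinehartAlgebra k R L]

/-- The flat `L`-connection on `U(L)` given by left multiplication. -/
noncomputable def envConn : FlatConnection k R L (Env k R L) := FlatConnection.ofModule (Env k R L)

/-- The comultiplication `Δ : U(L) → U(L) ⊗ U(L)` (tensor product of left `R`-modules):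
`Δ(u)` is the result of acting with `u` on `1 ⊗ 1`. It satisfies `Δ(f) = f ⊗ 1`,
`Δ(x) = x ⊗ 1 + 1 ⊗ x` and `Δ(x u) = ∇ₓ Δ(u)` for `f : R`, `x : L`. -/
noncomputable def envComul : Env k R L →ₗ[R] Env k R L ⊗[R] Env k R L where
  toFun u := ((envConn k).tensor (envConn k)).toAlgHom u (1 ⊗ₜ[R] 1)
  map_add' u v := by simp
  map_smul' f u := by simp [Env.smul_def, FlatConnection.toAlgHom_ofRing]

theorem envComul_ofRing (f : R) :
    envComul k (Env.ofRing k R L f) = Env.ofRing k R L f ⊗ₜ[R] 1 := by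
  simp [envComul, FlatConnection.toAlgHom_ofRing, TensorProduct.smul_tmul', Env.smul_def]

theorem envComul_ofLie (x : L) : envComul k (Env.ofLie k R L x) =
    Env.ofLie k R L x ⊗ₜ[R] 1 + 1 ⊗ₜ[R] Env.ofLie k R L x := by
  simp [envComul, FlatConnection.toAlgHom_ofLie, FlatConnection.tensor_nabla_tmul, envConn,
    FlatConnection.ofModule_nabla]

theorem envComul_ofLie_mul (x : L) (u : Env k R L) : envComul k (Env.ofLie k R L x * u) =
    ((envConn k).tensor (envConn k)).nabla x (envComul k u) := by
  simp [envComul, FlatConnection.toAlgHom_ofLie]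

variable (A : LieRinehartSubalgebra R L)

/-- The left ideal of `U(L)` generated by `A`. -/
noncomputable def leftIdeal : Submodule (Env k R L) (Env k R L) :=
  Submodule.span (Env k R L) (Set.range fun a : A => Env.ofLie k R L (a : L))

/-- The quotient `U(L) / U(L) A`. -/
def DOne : Type (max u v w) := Env k R L ⧸ leftIdeal k A

noncomputable instance : AddCommGroup (DOne k A) :=
  inferInstanceAs (AddCommGroup (Env k R L ⧸ leftIdeal k A))

noncomputable instance : Module (Env k R L) (DOne k A) :=
  inferInstanceAs (Module (Env k R L) (Env k R L ⧸ leftIdeal k A))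

noncomputable instance : Module R (DOne k A) :=
  inferInstanceAs (Module R (Env k R L ⧸ leftIdeal k A))

noncomputable instance : Module k (DOne k A) :=
  inferInstanceAs (Module k (Env k R L ⧸ leftIdeal k A))

instance : IsScalarTower k R (DOne k A) :=
  inferInstanceAs (IsScalarTower k R (Env k R L ⧸ leftIdeal k A))

instance : IsScalarTower R (Env k R L) (DOne k A) :=
  inferInstanceAs (IsScalarTower R (Env k R L) (Env k R L ⧸ leftIdeal k A))

namespace DOne

/-- The projection `U(L) → U(L) / U(L) A`. -/
noncomputable def mk : Env k R L →ₗ[Env k R L] DOne k A := (leftIdeal k A).mkQ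

theorem mk_surjective : Function.Surjective (mk k A) := (leftIdeal k A).mkQ_surjective

theorem mk_ofLie (a : A) : mk k A (Env.ofLie k R L a) = 0 :=
  (Submodule.Quotient.mk_eq_zero _).2 (Submodule.subset_span ⟨a, rfl⟩)

/-- The projection as an `R`-linear map. -/
noncomputable def mkR : Env k R L →ₗ[R] DOne k A := (mk k A).restrictScalars R

/-- The class of `1`. -/
noncomputable def one : DOne k A := mk k A 1

/-- The flat `L`-connection on `U(L) / U(L) A` given by left multiplication. -/
noncomputable def conn : FlatConnection k R L (DOne k A) := FlatConnection.ofModule (DOne k A)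

theorem conn_one (a : A) : (conn k A).nabla a (one k A) = 0 := by
  rw [conn, FlatConnection.ofModule_nabla, one, ← map_smul, smul_eq_mul, mul_one, mk_ofLie]

theorem map_envComul (u : Env k R L) :
    TensorProduct.map (mkR k A) (mkR k A) (envComul k u) =
      ((conn k A).tensor (conn k A)).toAlgHom u (one k A ⊗ₜ[R] one k A) := by
  change TensorProduct.map (mkR k A) (mkR k A) (FlatConnection.toAlgHom _ u _) = _
  rw [FlatConnection.toAlgHom_map _ ((conn k A).tensor (conn k A))]
  · rfl
  · intro x t
    induction t with
    | zero => simp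
    | tmul a b =>
      simp only [FlatConnection.tensor_nabla_tmul, map_add, TensorProduct.map_tmul]
      congr 1
    | add a b ha hb => simp only [map_add, ha, hb]

theorem map_envComul_of_mem (u : Env k R L) (hu : u ∈ leftIdeal k A) :
    TensorProduct.map (mkR k A) (mkR k A) (envComul k u) = 0 := by
  rw [map_envComul]
  induction hu using Submodule.span_induction with
  | mem x h =>
    obtain ⟨a, rfl⟩ := h
    simp [FlatConnection.toAlgHom_ofLie, FlatConnection.tensor_nabla_tmul, conn_one]
  | zero => simp
  | add x y _ _ hx hy => simp [hx, hy]
  | smul c x _ hx => simp [hx]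

/-- The comultiplication on `U(L) / U(L) A` induced by that of `U(L)`. -/
noncomputable def comul : DOne k A →ₗ[R] DOne k A ⊗[R] DOne k A :=
  (Submodule.liftQ ((leftIdeal k A).restrictScalars R)
    ((TensorProduct.map (mkR k A) (mkR k A)).comp (envComul k))
    (fun u hu => map_envComul_of_mem k A u hu)).comp
  (Submodule.Quotient.restrictScalarsEquiv R (leftIdeal k A)).symm.toLinearMap

theorem comul_mk (u : Env k R L) : comul k A (mk k A u) =
    TensorProduct.map (mkR k A) (mkR k A) (envComul k u) := rfl

theorem comul_one : comul k A (one k A) = one k A ⊗ₜ[R] one k A := by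
  rw [one, comul_mk, map_envComul]; simp; rfl

theorem comul_nabla (x : L) (p : DOne k A) : comul k A ((conn k A).nabla x p) =
    ((conn k A).tensor (conn k A)).nabla x (comul k A p) := by
  obtain ⟨u, rfl⟩ := mk_surjective k A p
  rw [conn, FlatConnection.ofModule_nabla, ← conn, ← map_smul, comul_mk, comul_mk, map_envComul,
    map_envComul, smul_eq_mul, map_mul, Module.End.mul_apply, FlatConnection.toAlgHom_ofLie]

/-- An `R`-linear condition on `U(L) / U(L) A` that is stable under the connection and holds for
the class of `1` holds everywhere. -/
theorem induction {P : DOne k A → Prop} (one : P (one k A))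
    (add : ∀ p q, P p → P q → P (p + q)) (smul : ∀ (f : R) p, P p → P (f • p))
    (nabla : ∀ x p, P p → P ((conn k A).nabla x p)) (p : DOne k A) : P p := by
  obtain ⟨u, rfl⟩ := mk_surjective k A p
  have key : ∀ u : Env k R L, ∀ p, P p → P (u • p) := by
    intro u
    induction u using Env.induction with
    | ring f =>
      intro p hp
      rw [show Env.ofRing k R L f • p = f • p by
        rw [← one_smul (Env k R L) p, ← smul_assoc f, Env.smul_def, mul_one, one_smul]]
      exact smul f p hp
    | lie x => intro p hp; exact nabla x p hp
    | mul a b ha hb => intro p hp; rw [mul_smul]; exact ha _ (hb _ hp)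
    | add a b ha hb => intro p hp; rw [add_smul]; exact add _ _ (ha _ hp) (hb _ hp)
  have := key u _ one
  rwa [DOne.one, ← map_smul, smul_eq_mul, mul_one] at this

theorem comm_comul (p : DOne k A) : TensorProduct.comm R _ _ (comul k A p) = comul k A p := by
  induction p using DOne.induction with
  | one => simp [comul_one]
  | add p q hp hq => simp [hp, hq]
  | smul f p hp => simp [hp]
  | nabla x p hp =>
    rw [comul_nabla]
    conv_rhs => rw [← hp]
    generalize comul k A p = t
    induction t with
    | zero => simp
    | tmul a b => simp [FlatConnection.tensor_nabla_tmul, add_comm]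
    | add a b ha hb => simp only [map_add, ha, hb]

end DOne

end Coalgebra

section Derivations

variable {k : Type u} {R : Type v} {L : Type w} [Field k] [CommRing R] [Algebra k R]
  [LieRing L] [LieAlgebra k L] [Module R L] [LieRingModule L R] [LieRinehartRing R L]
  [LieRinehartAlgebra k R L]

/-- The dual numbers `B[ε]` over `B`, as an algebra over `R` through `f ↦ f + (x f) ε`.
An `R`-algebra map `b ↦ b + D(b) ε` into it is a derivation `D` of `B` extending `x : R → R`. -/
def Dual (_R : Type v) {L : Type w} (_ : L) (B : Type*) : Type _ := TrivSqZeroExt B B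

namespace Dual

variable {B : Type*} [Ring B] [Algebra R B]

instance (x : L) : Ring (Dual R x B) := inferInstanceAs (Ring (TrivSqZeroExt B B))

/-- The element `a + b ε`. -/
def mk (x : L) (a b : B) : Dual R x B := (a, b)

theorem mk_add (x : L) (a b a' b' : B) :
    mk (R := R) x a b + mk x a' b' = mk x (a + a') (b + b') := rfl

theorem mk_mul (x : L) (a b a' b' : B) :
    mk (R := R) x a b * mk x a' b' = mk x (a * a') (a * b' + b * a') := rfl

theorem mk_one (x : L) : (1 : Dual R x B) = mk x 1 0 := rfl

theorem mk_zero (x : L) : (0 : Dual R x B) = mk x 0 0 := rfl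

instance (x : L) : Algebra R (Dual R x B) :=
  RingHom.toAlgebra'
    { toFun := fun f => mk x (algebraMap R B f) (algebraMap R B ⁅x, f⁆)
      map_one' := by
        have h : ⁅x, (1 : R)⁆ = 0 := by simpa using LieRinehartRing.leibniz_mul_right x (1 : R) 1
        rw [h, map_one, map_zero, mk_one]
      map_zero' := by rw [lie_zero, map_zero, mk_zero]
      map_add' := fun f g => by rw [lie_add, map_add, map_add, mk_add]
      map_mul' := fun f g => by
        rw [LieRinehartRing.leibniz_mul_right, mk_mul, map_mul, map_add, smul_eq_mul, map_mul,
          map_mul] }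
    (fun f b => by
      obtain ⟨b, c⟩ := b
      change mk x _ _ * mk x b c = mk x b c * mk x _ _
      rw [mk_mul, mk_mul, Algebra.commutes, Algebra.commutes f c, Algebra.commutes _ b, add_comm])

theorem algebraMap_def (x : L) (f : R) :
    algebraMap R (Dual R x B) f = mk x (algebraMap R B f) (algebraMap R B ⁅x, f⁆) := rfl

theorem smul_mk (x : L) (f : R) (a b : B) :
    f • mk (R := R) x a b = mk x (f • a) (f • b + ⁅x, f⁆ • a) := by
  rw [Algebra.smul_def, algebraMap_def, mk_mul, Algebra.smul_def, Algebra.smul_def,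
    Algebra.smul_def]

/-- The `R`-linear map `m ↦ j(m) + j(∇ₓ m) ε`. -/
def lin {M : Type*} [AddCommGroup M] [Module k M] [Module R M] (C : FlatConnection k R L M)
    (j : M →ₗ[R] B) (x : L) : M →ₗ[R] Dual R x B where
  toFun m := mk x (j m) (j (C.nabla x m))
  map_add' a b := by simp [mk_add]
  map_smul' f a := by simp [smul_mk, C.leibniz]

end Dual

section Even

variable {B : Type*} [Ring B] [Algebra R B] [Module k B] [IsScalarTower k R B]
  {M : Type*} [AddCommGroup M] [Module k M] [Module R M]
  (C : FlatConnection k R L M) (j : M →ₗ[R] B)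
  (Φ : ∀ x : L, B →ₐ[R] Dual R x B)

theorem gen_induction {B : Type*} [Ring B] [Algebra R B]
    {M : Type*} [AddCommGroup M] [Module R M] (j : M →ₗ[R] B)
    (hj : Algebra.adjoin R (Set.range j) = ⊤) {P : B → Prop} (alg : ∀ f, P (algebraMap R B f)) (gen : ∀ m, P (j m))
    (add : ∀ a b, P a → P b → P (a + b)) (mul : ∀ a b, P a → P b → P (a * b)) (b : B) : P b := by
  have hb : b ∈ Algebra.adjoin R (Set.range j) := by rw [hj]; trivial
  induction hb using Algebra.adjoin_induction with
  | mem x hx => obtain ⟨m, rfl⟩ := hx; exact gen m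
  | algebraMap r => exact alg r
  | add x y _ _ hx hy => exact add _ _ hx hy
  | mul x y _ _ hx hy => exact mul _ _ hx hy


theorem even_fst (hj : Algebra.adjoin R (Set.range j) = ⊤)
    (hΦ : ∀ x m, Φ x (j m) = Dual.mk x (j m) (j (C.nabla x m))) (x : L) (b : B) : Φ x b = Dual.mk x b (Φ x b).2 := by
  induction b using gen_induction j hj with
  | alg f => rw [AlgHom.commutes]; rfl
  | gen m => rw [hΦ]; rfl
  | add a b ha hb =>
    rw [map_add, ha, hb, Dual.mk_add]; rfl
  | mul a b ha hb =>
    rw [map_mul, ha, hb, Dual.mk_mul]; rfl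

/-- The additive map `b ↦ D(b)` where `Φ(b) = b + D(b) ε`. -/
def evenAux (x : L) : B →+ B :=
  AddMonoidHom.mk' (fun b => (Φ x b).2) (fun a b => by rw [map_add]; rfl)

theorem evenAux_alg (x : L) (f : R) :
    evenAux Φ x (algebraMap R B f) = algebraMap R B ⁅x, f⁆ := by
  change (Φ x _).2 = _
  rw [AlgHom.commutes]; rfl

theorem evenAux_gen (hΦ : ∀ x m, Φ x (j m) = Dual.mk x (j m) (j (C.nabla x m))) (x : L) (m : M) : evenAux Φ x (j m) = j (C.nabla x m) := by
  change (Φ x _).2 = _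
  rw [hΦ]; rfl

theorem evenAux_mul (hj : Algebra.adjoin R (Set.range j) = ⊤)
    (hΦ : ∀ x m, Φ x (j m) = Dual.mk x (j m) (j (C.nabla x m))) (x : L) (a b : B) :
    evenAux Φ x (a * b) = a * evenAux Φ x b + evenAux Φ x a * b := by
  change (Φ x _).2 = _
  rw [map_mul, even_fst C j Φ hj hΦ x a, even_fst C j Φ hj hΦ x b, Dual.mk_mul]; rfl

/-- Given an `R`-algebra `B` generated by the image of `j : M → B` and a flat connection on `M`,
the flat connection on `B` whose covariant derivatives are derivations of `B` extending those of
`M`; the algebra maps `Φ x` witness that these derivations exist. -/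
def evenConn (hj : Algebra.adjoin R (Set.range j) = ⊤)
    (hΦ : ∀ x m, Φ x (j m) = Dual.mk x (j m) (j (C.nabla x m)))
    : FlatConnection k R L B :=
  FlatConnection.ofAddHom (evenAux Φ)
    (fun x y b => by
      induction b using gen_induction j hj with
      | alg f => simp only [evenAux_alg, add_lie, map_add]
      | gen m => simp only [evenAux_gen C j Φ hΦ, map_add, LinearMap.add_apply]
      | add a b ha hb => simp only [map_add, ha, hb]; abel
      | mul a b ha hb => simp only [evenAux_mul C j Φ hj hΦ, ha, hb]; noncomm_ring)
    (fun x y b => by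
      induction b using gen_induction j hj with
      | alg f => simp only [evenAux_alg, lie_lie, map_sub]
      | gen m => simp only [evenAux_gen C j Φ hΦ, C.map_lie, map_sub]
      | add a b ha hb => simp only [map_add, ha, hb]; abel
      | mul a b ha hb =>
        simp only [evenAux_mul C j Φ hj hΦ, ha, hb, map_add]; noncomm_ring)
    (fun f x b => by
      induction b using gen_induction j hj with
      | alg g =>
        simp only [evenAux_alg, LieRinehartRing.lie_smul_eq_mul, map_mul, Algebra.smul_def]
      | gen m => simp only [evenAux_gen C j Φ hΦ, C.map_smul, map_smul]
      | add a b ha hb => simp only [map_add, ha, hb, smul_add]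
      | mul a b ha hb =>
        simp only [evenAux_mul C j Φ hj hΦ, ha, hb, smul_add, mul_smul_comm, smul_mul_assoc])
    (fun x f b => by
      rw [Algebra.smul_def, evenAux_mul C j Φ hj hΦ, evenAux_alg, ← Algebra.smul_def,
        ← Algebra.smul_def])

theorem evenConn_gen (hj : Algebra.adjoin R (Set.range j) = ⊤)
    (hΦ : ∀ x m, Φ x (j m) = Dual.mk x (j m) (j (C.nabla x m)))
    (x : L) (m : M) :
    (evenConn C j Φ hj hΦ).nabla x (j m) = j (C.nabla x m) := evenAux_gen C j Φ hΦ x m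

theorem evenConn_alg (hj : Algebra.adjoin R (Set.range j) = ⊤)
    (hΦ : ∀ x m, Φ x (j m) = Dual.mk x (j m) (j (C.nabla x m)))
    (x : L) (f : R) :
    (evenConn C j Φ hj hΦ).nabla x (algebraMap R B f) = algebraMap R B ⁅x, f⁆ :=
  evenAux_alg Φ x f

theorem evenConn_mul (hj : Algebra.adjoin R (Set.range j) = ⊤)
    (hΦ : ∀ x m, Φ x (j m) = Dual.mk x (j m) (j (C.nabla x m)))
    (x : L) (a b : B) : (evenConn C j Φ hj hΦ).nabla x (a * b) =
    a * (evenConn C j Φ hj hΦ).nabla x b + (evenConn C j Φ hj hΦ).nabla x a * b :=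
  evenAux_mul C j Φ hj hΦ x a b

end Even

section Odd

variable {B : Type*} [Ring B] [Algebra R B] {M : Type*} [AddCommGroup M] [Module R M]
  (j : M →ₗ[R] B) (α : B →ₐ[R] B) (δ : M →ₗ[R] B)

/-- The `R`-linear map sending `m` to the triangular matrix with rows `(α (j m), δ m)` and
`(0, j m)`. An algebra map `b ↦ [[α b, D b], [0, b]]` amounts to an `α`-twisted derivation `D`,
i.e. `D (a b) = D(a) b + α(a) D(b)`. -/
def oddLin : M →ₗ[R] Matrix (Fin 2) (Fin 2) B where
  toFun m := !![α (j m), δ m; 0, j m]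
  map_add' a b := by simp [Matrix.of_add_of]
  map_smul' f a := by simp [Matrix.smul_of]

variable (Ψ : B →ₐ[R] Matrix (Fin 2) (Fin 2) B)

/-- The upper right entry of `Ψ`. -/
def oddDer : B →ₗ[R] B where
  toFun b := Ψ b 0 1
  map_add' a b := by simp
  map_smul' f a := by simp

theorem oddDer_alg (f : R) : oddDer Ψ (algebraMap R B f) = 0 := by
  simp [oddDer, Matrix.algebraMap_matrix_apply]

theorem oddDer_gen (hΨ : ∀ m, Ψ (j m) = oddLin j α δ m) (m : M) : oddDer Ψ (j m) = δ m := by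
  simp [oddDer, hΨ, oddLin]

theorem odd_eq (hj : Algebra.adjoin R (Set.range j) = ⊤)
    (hΨ : ∀ m, Ψ (j m) = oddLin j α δ m) (b : B) : Ψ b 0 0 = α b ∧ Ψ b 1 0 = 0 ∧ Ψ b 1 1 = b := by
  induction b using gen_induction j hj with
  | alg f => simp [Matrix.algebraMap_matrix_apply]
  | gen m => simp [hΨ, oddLin]
  | add a b ha hb => simp [ha, hb]
  | mul a b ha hb => simp [ha, hb, Matrix.mul_apply, Fin.sum_univ_two]

theorem oddDer_mul (hj : Algebra.adjoin R (Set.range j) = ⊤)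
    (hΨ : ∀ m, Ψ (j m) = oddLin j α δ m) (a b : B) : oddDer Ψ (a * b) = oddDer Ψ a * b + α a * oddDer Ψ b := by
  have ha := odd_eq j α δ Ψ hj hΨ a
  have hb := odd_eq j α δ Ψ hj hΨ b
  simp [oddDer, ha, hb, Matrix.mul_apply, Fin.sum_univ_two, add_comm]

end Odd

end Derivations

section Poly

variable (k : Type u) {R : Type v} {L : Type w} [Field k] [CommRing R] [Algebra k R]
  [LieRing L] [LieAlgebra k L] [Module R L] [LieRingModule L R] [LieRinehartRing R L]
  [LieRinehartAlgebra k R L] (A : LieRinehartSubalgebra R L)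

/-- The tensor algebra over `R` of `U(L) / U(L) A`. Its product is the cup product. -/
abbrev Poly : Type (max u v w) := TensorAlgebra R (DOne k A)

namespace Poly

/-- The inclusion of `U(L) / U(L) A` as the tensors of degree one. -/
noncomputable abbrev inc : DOne k A →ₗ[R] Poly k A := TensorAlgebra.ι R

/-- The tensors of degree `n`, i.e. the `n`-th tensor power of `U(L) / U(L) A`. -/
noncomputable def deg (n : ℕ) : Submodule R (Poly k A) := LinearMap.range (inc k A) ^ n

theorem inc_mem (p : DOne k A) : inc k A p ∈ deg k A 1 := by
  rw [deg, pow_one]; exact ⟨p, rfl⟩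

theorem mul_mem {i j : ℕ} {a b : Poly k A} (ha : a ∈ deg k A i) (hb : b ∈ deg k A j) :
    a * b ∈ deg k A (i + j) := by
  rw [deg, pow_add]; exact Submodule.mul_mem_mul ha hb

theorem alg_mem (f : R) : algebraMap R (Poly k A) f ∈ deg k A 0 := by
  rw [deg, pow_zero]; exact Submodule.algebraMap_mem f

theorem deg_induction {P : ℕ → Poly k A → Prop} (alg : ∀ f, P 0 (algebraMap R _ f))
    (add : ∀ (n : ℕ) a b, P n a → P n b → P n (a + b))
    (mul : ∀ n p a, a ∈ deg k A n → P n a → P (n + 1) (inc k A p * a)) {n : ℕ} {a : Poly k A}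
    (ha : a ∈ deg k A n) : P n a := by
  induction ha using Submodule.pow_induction_on_left' with
  | algebraMap r => exact alg r
  | add x y i _ _ hx hy => exact add _ _ _ hx hy
  | mem_mul m hm i x hx h => obtain ⟨p, rfl⟩ := hm; exact mul _ _ _ hx h

/-- The flat `L`-connection on the tensor algebra: covariant derivatives act as derivations. -/
noncomputable def conn : FlatConnection k R L (Poly k A) :=
  evenConn (DOne.conn k A) (inc k A)
    (fun x => TensorAlgebra.lift R (Dual.lin (DOne.conn k A) (inc k A) x))
    TensorAlgebra.adjoin_range_ι
    (fun _ _ => TensorAlgebra.lift_ι_apply _ _)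

theorem conn_inc (x : L) (p : DOne k A) :
    (conn k A).nabla x (inc k A p) = inc k A ((DOne.conn k A).nabla x p) := evenConn_gen ..

theorem conn_alg (x : L) (f : R) :
    (conn k A).nabla x (algebraMap R _ f) = algebraMap R _ ⁅x, f⁆ := evenConn_alg ..

theorem conn_mul (x : L) (a b : Poly k A) : (conn k A).nabla x (a * b) =
    a * (conn k A).nabla x b + (conn k A).nabla x a * b := evenConn_mul ..

theorem conn_mem (x : L) {n : ℕ} {a : Poly k A} (ha : a ∈ deg k A n) :
    (conn k A).nabla x a ∈ deg k A n := by
  refine deg_induction k A (P := fun n a => (conn k A).nabla x a ∈ deg k A n) ?_ ?_ ?_ ha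
  · intro f; rw [conn_alg]; exact alg_mem k A _
  · intro n a b ha hb; rw [map_add]; exact add_mem ha hb
  · intro n p a ha h
    rw [conn_mul, conn_inc, add_comm n 1]
    exact add_mem (mul_mem k A (inc_mem k A p) h) (mul_mem k A (inc_mem k A _) ha)

/-- The grade involution: multiplication by `(-1)^n` in degree `n`. -/
noncomputable def inv : Poly k A →ₐ[R] Poly k A := TensorAlgebra.lift R (-inc k A)

theorem inv_inc (p : DOne k A) : inv k A (inc k A p) = -inc k A p := by
  simp [inv]

theorem inv_of_mem {n : ℕ} {a : Poly k A} (ha : a ∈ deg k A n) :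
    inv k A a = (-1) ^ n * a := by
  refine deg_induction k A (P := fun n a => inv k A a = (-1) ^ n * a) ?_ ?_ ?_ ha
  · intro f; simp
  · intro n a b ha hb; rw [map_add, ha, hb, mul_add]
  · intro n p a _ h
    rw [map_mul, inv_inc, h, pow_succ, neg_mul, mul_neg_one, neg_mul, ← mul_assoc, ← mul_assoc,
      ((Commute.neg_one_left (inc k A p)).pow_left n).eq]

/-- The comultiplication of `U(L) / U(L) A` with values in the tensors of degree two. -/
noncomputable def comul : DOne k A →ₗ[R] Poly k A :=
  (TensorProduct.lift ((LinearMap.mul R (Poly k A)).compl₁₂ (inc k A) (inc k A))).comp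
    (DOne.comul k A)

/-- `∑ (-1)^(i-1) p₁ ⊗ ⋯ ⊗ Δ pᵢ ⊗ ⋯ ⊗ pₙ`, i.e. the `α`-twisted derivation of the tensor algebra
extending the comultiplication, where `α` is the grade involution. -/
noncomputable def dComul : Poly k A →ₗ[R] Poly k A :=
  oddDer (TensorAlgebra.lift R (oddLin (inc k A) (inv k A) (comul k A)))

/-- The class of `1`, as a tensor of degree one. -/
noncomputable def e : Poly k A := inc k A (DOne.one k A)

/-- The coboundary operator, sending `P = p₁ ⊗ ⋯ ⊗ pₙ` to
`1 ⊗ P - ∑ (-1)^(i-1) p₁ ⊗ ⋯ ⊗ Δ pᵢ ⊗ ⋯ ⊗ pₙ - (-1)^n P ⊗ 1`; see `d_prod`. -/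
noncomputable def d : Poly k A →ₗ[R] Poly k A :=
  LinearMap.mulLeft R (e k A) - dComul k A -
    (LinearMap.mulRight R (e k A)).comp (inv k A).toLinearMap

theorem d_def (a : Poly k A) :
    d k A a = e k A * a - dComul k A a - inv k A a * e k A := rfl

theorem dComul_alg (f : R) : dComul k A (algebraMap R _ f) = 0 := oddDer_alg _ f

theorem dComul_inc (p : DOne k A) : dComul k A (inc k A p) = comul k A p :=
  oddDer_gen (inc k A) (inv k A) (comul k A) _ (fun _ => TensorAlgebra.lift_ι_apply _ _) p

theorem dComul_mul (a b : Poly k A) :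
    dComul k A (a * b) = dComul k A a * b + inv k A a * dComul k A b :=
  oddDer_mul (inc k A) (inv k A) (comul k A) _ TensorAlgebra.adjoin_range_ι
    (fun _ => TensorAlgebra.lift_ι_apply _ _) a b

theorem d_alg (f : R) : d k A (algebraMap R _ f) = 0 := by
  rw [d_def, dComul_alg, AlgHom.commutes, Algebra.commutes]; simp

theorem d_inc (p : DOne k A) :
    d k A (inc k A p) = e k A * inc k A p - comul k A p + inc k A p * e k A := by
  rw [d_def, dComul_inc, inv_inc]; noncomm_ring

theorem d_mul (a b : Poly k A) : d k A (a * b) = d k A a * b + inv k A a * d k A b := by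
  simp only [d_def, dComul_mul, map_mul]; noncomm_ring

/-- The explicit formula for the coboundary operator on decomposable tensors. -/
theorem d_prod (l : List (DOne k A)) :
    d k A (l.map (inc k A)).prod = e k A * (l.map (inc k A)).prod +
      ∑ i : Fin l.length, (-1) ^ (i.val + 1) *
        (((l.take i).map (inc k A)).prod * comul k A l[i] *
          ((l.drop (i + 1)).map (inc k A)).prod) +
      (-1) ^ (l.length + 1) * ((l.map (inc k A)).prod * e k A) := by
  have hinv : ∀ l : List (DOne k A),
      inv k A (l.map (inc k A)).prod = (-1) ^ l.length * (l.map (inc k A)).prod := by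
    intro l
    induction l with
    | nil => simp
    | cons p l ih =>
      rw [List.map_cons, List.prod_cons, map_mul, ih, inv_inc, List.length_cons, pow_succ,
        neg_mul, mul_neg_one, neg_mul, ← mul_assoc, ← mul_assoc,
        ((Commute.neg_one_left (inc k A p)).pow_left l.length).eq]
  have hco : dComul k A (l.map (inc k A)).prod = ∑ i : Fin l.length, (-1) ^ i.val *
        (((l.take i).map (inc k A)).prod * comul k A l[i] *
          ((l.drop (i + 1)).map (inc k A)).prod) := by
    induction l with
    | nil => simpa using dComul_alg k A 1
    | cons p l ih =>
      rw [List.map_cons, List.prod_cons, dComul_mul, ih, dComul_inc, inv_inc,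
        show ∑ i : Fin (p :: l).length, _ = _ from Fin.sum_univ_succ (n := l.length) _,
        Finset.mul_sum]
      congr 1
      · simp
      · refine Finset.sum_congr rfl fun i _ => ?_
        have h := ((Commute.neg_one_left (inc k A p)).pow_left i.val).eq
        simp only [Fin.val_succ, List.take_succ_cons, List.map_cons, List.prod_cons,
          List.drop_succ_cons, pow_succ, mul_neg_one, neg_mul, ← mul_assoc, h]
        rfl
  rw [d_def, hco, hinv, sub_eq_add_neg, sub_eq_add_neg, ← Finset.sum_neg_distrib]
  simp only [pow_succ, mul_neg_one, neg_mul, mul_assoc]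

theorem lift_mem (t : DOne k A ⊗[R] DOne k A) :
    TensorProduct.lift ((LinearMap.mul R (Poly k A)).compl₁₂ (inc k A) (inc k A)) t ∈
      deg k A 2 := by
  induction t with
  | zero => simp
  | tmul p q => exact mul_mem k A (inc_mem k A p) (inc_mem k A q)
  | add a b ha hb => rw [map_add]; exact add_mem ha hb

theorem d_mem {n : ℕ} {a : Poly k A} (ha : a ∈ deg k A n) : d k A a ∈ deg k A (n + 1) := by
  refine deg_induction k A (P := fun n a => d k A a ∈ deg k A (n + 1)) ?_ ?_ ?_ ha
  · intro f; rw [d_alg]; exact zero_mem _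
  · intro n a b ha hb; rw [map_add]; exact add_mem ha hb
  · intro n p a ha h
    rw [d_mul, d_inc, inv_inc]
    have h1 : n + 1 + 1 = 2 + n := by omega
    have h2 : n + 1 + 1 = 1 + (n + 1) := by omega
    refine add_mem ?_ ?_
    · rw [h1]
      exact mul_mem k A (add_mem (sub_mem (mul_mem k A (inc_mem k A _) (inc_mem k A p))
        (lift_mem k A _)) (mul_mem k A (inc_mem k A p) (inc_mem k A _))) ha
    · rw [h2]
      exact mul_mem k A (neg_mem (inc_mem k A p)) h

theorem inv_conn (x : L) (a : Poly k A) :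
    inv k A ((conn k A).nabla x a) = (conn k A).nabla x (inv k A a) := by
  induction a using TensorAlgebra.induction with
  | algebraMap f => simp [conn_alg]
  | ι p =>
    have := conn_inc k A x p
    rw [this, inv_inc, inv_inc, map_neg, this]
  | mul a b ha hb => simp only [conn_mul, map_mul, map_add, ha, hb]
  | add a b ha hb => simp only [map_add, ha, hb]

theorem inv_comul (p : DOne k A) : inv k A (comul k A p) = comul k A p := by
  have h : comul k A p ∈ deg k A 2 := lift_mem k A (DOne.comul k A p)
  rw [inv_of_mem k A h]; simp

theorem inv_dComul (a : Poly k A) :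
    inv k A (dComul k A a) = -dComul k A (inv k A a) := by
  induction a using TensorAlgebra.induction with
  | algebraMap f => simp [dComul_alg]
  | ι p =>
    have h1 := dComul_inc k A p
    have h2 := inv_inc k A p
    rw [h1, h2, map_neg, neg_neg, h1, inv_comul]
  | mul a b ha hb => simp only [dComul_mul, map_mul, map_add, ha, hb]; noncomm_ring
  | add a b ha hb => simp only [map_add, ha, hb]; abel

theorem inv_inv (a : Poly k A) : inv k A (inv k A a) = a := by
  induction a using TensorAlgebra.induction with
  | algebraMap f => simp
  | ι p =>
    have h2 := inv_inc k A p
    rw [h2, map_neg, h2, neg_neg]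
  | mul a b ha hb => simp only [map_mul, ha, hb]
  | add a b ha hb => simp only [map_add, ha, hb]

theorem inv_d (a : Poly k A) : inv k A (d k A a) = -d k A (inv k A a) := by
  simp only [d_def, map_sub, map_mul, inv_dComul, inv_inv]
  rw [e, inv_inc]; noncomm_ring

theorem comul_nabla (x : L) (p : DOne k A) :
    comul k A ((DOne.conn k A).nabla x p) = (conn k A).nabla x (comul k A p) := by
  simp only [comul, LinearMap.comp_apply, DOne.comul_nabla]
  generalize DOne.comul k A p = t
  induction t with
  | zero => simp
  | tmul a b =>
    simp [FlatConnection.tensor_nabla_tmul, conn_mul, conn_inc, add_comm]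
  | add a b ha hb => simp only [map_add, ha, hb]

theorem dComul_conn (x : L) (a : Poly k A) :
    dComul k A ((conn k A).nabla x a) = (conn k A).nabla x (dComul k A a) := by
  induction a using TensorAlgebra.induction with
  | algebraMap f => simp [conn_alg, dComul_alg]
  | ι p =>
    have h1 := conn_inc k A x p
    have h2 := dComul_inc k A
    rw [h1, h2, h2, comul_nabla]
  | mul a b ha hb =>
    simp only [conn_mul, dComul_mul, map_add, ha, hb, inv_conn]; abel
  | add a b ha hb => simp only [map_add, ha, hb]

theorem dComul_comul (p : DOne k A) : dComul k A (comul k A p) = 0 := by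
  induction p using DOne.induction with
  | one =>
    simp only [comul, LinearMap.comp_apply, DOne.comul_one, TensorProduct.lift.tmul,
      LinearMap.compl₁₂_apply, LinearMap.mul_apply', dComul_mul, dComul_inc, inv_inc]
    noncomm_ring
  | add p q hp hq => rw [map_add, map_add, hp, hq, add_zero]
  | smul f p hp => rw [map_smul, map_smul, hp, smul_zero]
  | nabla x p hp => rw [comul_nabla, dComul_conn, hp, map_zero]

theorem d_d (a : Poly k A) : d k A (d k A a) = 0 := by
  induction a using TensorAlgebra.induction with
  | algebraMap f => rw [d_alg, map_zero]
  | ι p =>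
    have h1 := d_inc k A
    have h2 : d k A (comul k A p) = e k A * comul k A p - comul k A p * e k A := by
      rw [d_def, dComul_comul, inv_comul, sub_zero]
    have h3 : d k A (e k A) = e k A * e k A := by
      rw [e, h1]
      simp only [comul, LinearMap.comp_apply, DOne.comul_one, TensorProduct.lift.tmul,
        LinearMap.compl₁₂_apply, LinearMap.mul_apply', e]
      noncomm_ring
    have h4 : inv k A (e k A) = -e k A := inv_inc k A _
    rw [h1]
    simp only [map_add, map_sub, d_mul, h1, h2, h3, h4, inv_inc]
    noncomm_ring
  | mul a b ha hb => simp only [d_mul, map_add, inv_d, ha, hb, inv_inv]; noncomm_ring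
  | add a b ha hb => simp only [map_add, ha, hb, add_zero]

theorem d_conn (x : A) (a : Poly k A) :
    d k A ((conn k A).nabla x a) = (conn k A).nabla x (d k A a) := by
  have h : (conn k A).nabla x (e k A) = 0 := by
    rw [e, conn_inc, DOne.conn_one, map_zero]
  simp only [d_def, map_sub, conn_mul, dComul_conn, inv_conn, h]
  noncomm_ring

end Poly

/-- The free graded Lie algebra generated over `R` by `U(L) / U(L) A` in degree one: the smallest
`R`-submodule of the tensor algebra that contains `U(L) / U(L) A` and is closed under the graded
bracket `[u, v] = u ⊗ v - (-1)^(i j) v ⊗ u` of elements of degrees `i` and `j`. -/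
noncomputable def freeLie : Submodule R (Poly k A) :=
  sInf {N | LinearMap.range (Poly.inc k A) ≤ N ∧ ∀ (i j : ℕ) (u v : Poly k A),
    u ∈ Poly.deg k A i → v ∈ Poly.deg k A j → u ∈ N → v ∈ N →
      u * v - (-1) ^ (i * j) * (v * u) ∈ N}

namespace freeLie

theorem inc_mem (p : DOne k A) : Poly.inc k A p ∈ freeLie k A :=
  Submodule.mem_sInf.2 fun _ hN => hN.1 ⟨p, rfl⟩

theorem bracket_mem {i j : ℕ} {u v : Poly k A} (hi : u ∈ Poly.deg k A i) (hj : v ∈ Poly.deg k A j)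
    (hu : u ∈ freeLie k A) (hv : v ∈ freeLie k A) :
    u * v - (-1) ^ (i * j) * (v * u) ∈ freeLie k A :=
  Submodule.mem_sInf.2 fun N hN => hN.2 i j u v hi hj (Submodule.mem_sInf.1 hu N hN)
    (Submodule.mem_sInf.1 hv N hN)

theorem le_of (N : Submodule R (Poly k A)) (hinc : ∀ p, Poly.inc k A p ∈ N)
    (hbr : ∀ (i j : ℕ) (u v : Poly k A), u ∈ Poly.deg k A i → v ∈ Poly.deg k A j →
      u ∈ freeLie k A → v ∈ freeLie k A → u ∈ N → v ∈ N →
      u * v - (-1) ^ (i * j) * (v * u) ∈ N) : freeLie k A ≤ N := by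
  have : freeLie k A ≤ freeLie k A ⊓ N := by
    refine sInf_le ⟨?_, ?_⟩
    · rintro _ ⟨p, rfl⟩; exact ⟨inc_mem k A p, hinc p⟩
    · intro i j u v hi hj hu hv
      exact ⟨bracket_mem k A hi hj hu.1 hv.1, hbr i j u v hi hj hu.1 hv.1 hu.2 hv.2⟩
  exact this.trans inf_le_right

theorem sign_mem {N : Submodule R (Poly k A)} (n : ℕ) {u : Poly k A} (hu : u ∈ N) :
    (-1) ^ n * u ∈ N := by
  rcases neg_one_pow_eq_or (Poly k A) n with h | h <;> simp [h, hu]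

theorem inv_mem {u : Poly k A} (hu : u ∈ freeLie k A) : Poly.inv k A u ∈ freeLie k A := by
  refine le_of k A ((freeLie k A).comap (Poly.inv k A).toLinearMap) ?_ ?_ hu
  · intro p
    change Poly.inv k A _ ∈ freeLie k A
    rw [Poly.inv_inc]; exact neg_mem (inc_mem k A p)
  · intro i j u v hi hj hu hv hu' hv'
    change Poly.inv k A _ ∈ freeLie k A
    have : u * v - (-1) ^ (i * j) * (v * u) ∈ Poly.deg k A (i + j) :=
      sub_mem (Poly.mul_mem k A hi hj)
        (sign_mem k A _ (by rw [add_comm]; exact Poly.mul_mem k A hj hi))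
    rw [Poly.inv_of_mem k A this]
    exact sign_mem k A _ (bracket_mem k A hi hj hu hv)

theorem conn_mem (x : L) {u : Poly k A} (hu : u ∈ freeLie k A) :
    (Poly.conn k A).nabla x u ∈ freeLie k A := by
  have : freeLie k A ≤ { (freeLie k A).toAddSubmonoid.comap
      ((Poly.conn k A).nabla x : Poly k A →+ Poly k A) ⊓ (freeLie k A).toAddSubmonoid with
    smul_mem' := fun f u hu => ⟨by
      change (Poly.conn k A).nabla x (f • u) ∈ freeLie k A
      rw [(Poly.conn k A).leibniz]
      exact add_mem (Submodule.smul_mem _ _ hu.1) (Submodule.smul_mem _ _ hu.2),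
      (freeLie k A).smul_mem f hu.2⟩ } := by
    refine le_of k A _ ?_ ?_
    · intro p
      refine ⟨?_, inc_mem k A p⟩
      change (Poly.conn k A).nabla x _ ∈ freeLie k A
      rw [Poly.conn_inc]; exact inc_mem k A _
    · intro i j u v hi hj hu hv hu' hv'
      refine ⟨?_, bracket_mem k A hi hj hu hv⟩
      change (Poly.conn k A).nabla x _ ∈ freeLie k A
      have h1 := bracket_mem k A (Poly.conn_mem k A x hi) hj hu'.1 hv
      have h2 := bracket_mem k A hi (Poly.conn_mem k A x hj) hu hv'.1
      have h3 := add_mem h1 h2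
      have hs (w : Poly k A) : (Poly.conn k A).nabla x ((-1) ^ (i * j) * w) =
          (-1) ^ (i * j) * (Poly.conn k A).nabla x w := by
        rcases neg_one_pow_eq_or (Poly k A) (i * j) with h | h <;> simp [h]
      convert h3 using 1
      simp only [map_sub, hs, Poly.conn_mul]
      noncomm_ring
  exact (this hu).1

theorem comul_mem [CharZero k] (p : DOne k A) : Poly.comul k A p ∈ freeLie k A := by
  have key (t : DOne k A ⊗[R] DOne k A) :
      TensorProduct.lift ((LinearMap.mul R (Poly k A)).compl₁₂ (Poly.inc k A) (Poly.inc k A)) t +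
      TensorProduct.lift ((LinearMap.mul R (Poly k A)).compl₁₂ (Poly.inc k A) (Poly.inc k A))
        (TensorProduct.comm R _ _ t) ∈ freeLie k A := by
    induction t with
    | zero => simp
    | tmul a b =>
      have := bracket_mem k A (Poly.inc_mem k A a) (Poly.inc_mem k A b) (inc_mem k A a)
        (inc_mem k A b)
      simpa using this
    | add a b ha hb =>
      simp only [map_add]
      convert add_mem ha hb using 1
      abel
  have h := key (DOne.comul k A p)
  rw [DOne.comm_comul] at h
  have h2 := (freeLie k A).smul_mem (algebraMap k R 2⁻¹) h
  rw [algebraMap_smul, ← two_smul k, smul_smul, inv_mul_cancel₀ two_ne_zero, one_smul] at h2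
  exact h2

theorem d_mem [CharZero k] {u : Poly k A} (hu : u ∈ freeLie k A) :
    Poly.d k A u ∈ freeLie k A := by
  refine le_of k A ((freeLie k A).comap (Poly.d k A)) ?_ ?_ hu
  · intro p
    change Poly.d k A _ ∈ freeLie k A
    have := bracket_mem k A (Poly.inc_mem k A (DOne.one k A)) (Poly.inc_mem k A p)
      (inc_mem k A _) (inc_mem k A p)
    have h := sub_mem this (comul_mem k A p)
    rw [Poly.d_inc, Poly.e]
    convert h using 1
    simp; abel
  · intro i j u v hi hj hu hv hu' hv'
    change Poly.d k A _ ∈ freeLie k A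
    have h1 := bracket_mem k A (Poly.d_mem k A hi) hj hu' hv
    have h2 := sign_mem k A i (bracket_mem k A hi (Poly.d_mem k A hj) hu hv')
    have h3 := add_mem h1 h2
    convert h3 using 1
    have hs (w : Poly k A) : Poly.d k A ((-1) ^ (i * j) * w) =
        (-1) ^ (i * j) * Poly.d k A w := by
      rcases neg_one_pow_eq_or (Poly k A) (i * j) with h | h <;> simp [h]
    simp only [map_sub, hs, Poly.d_mul, Poly.inv_of_mem k A hi, Poly.inv_of_mem k A hj, add_mul,
      mul_add, pow_add, one_mul, mul_one]
    rcases neg_one_pow_eq_or (Poly k A) i with h | h <;>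
    rcases neg_one_pow_eq_or (Poly k A) j with h' | h' <;>
    rcases neg_one_pow_eq_or (Poly k A) (i * j) with h'' | h'' <;>
    simp [h, h', h''] <;> noncomm_ring

end freeLie

end Poly
section Sym

variable (k : Type u) {R : Type v} {L : Type w} [Field k] [CommRing R] [Algebra k R]
  [LieRing L] [LieAlgebra k L] [Module R L] [LieRingModule L R] [LieRinehartRing R L]
  [LieRinehartAlgebra k R L] (A : LieRinehartSubalgebra R L)

/-- The relations `x ⊙ y = (-1)^(i j) y ⊙ x` for `x`, `y` homogeneous of degrees `i`, `j`. -/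
inductive SymRel : TensorAlgebra R (freeLie k A) → TensorAlgebra R (freeLie k A) → Prop
  | comm (i j : ℕ) (x y : freeLie k A) (hx : (x : Poly k A) ∈ Poly.deg k A i)
      (hy : (y : Poly k A) ∈ Poly.deg k A j) :
      SymRel (TensorAlgebra.ι R x * TensorAlgebra.ι R y)
        ((-1) ^ (i * j) * (TensorAlgebra.ι R y * TensorAlgebra.ι R x))

/-- The graded symmetric algebra over `R` of the free graded Lie algebra. -/
def Sym : Type (max u v w) := RingQuot (SymRel k A)

namespace Sym

noncomputable instance : Ring (Sym k A) := inferInstanceAs (Ring (RingQuot (SymRel k A)))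

noncomputable instance : Algebra R (Sym k A) :=
  inferInstanceAs (Algebra R (RingQuot (SymRel k A)))

noncomputable instance : Module k (Sym k A) := Module.compHom _ (algebraMap k R)

instance : IsScalarTower k R (Sym k A) :=
  ⟨fun c f s => by
    rw [Algebra.smul_def c f, mul_smul]; rfl⟩

/-- The projection from the tensor algebra. -/
noncomputable def proj : TensorAlgebra R (freeLie k A) →ₐ[R] Sym k A :=
  RingQuot.mkAlgHom R (SymRel k A)

/-- The canonical map from the free graded Lie algebra to its graded symmetric algebra. -/
noncomputable def inc : freeLie k A →ₗ[R] Sym k A :=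
  (proj k A).toLinearMap.comp (TensorAlgebra.ι R)

theorem inc_comm {i j : ℕ} {x y : freeLie k A} (hx : (x : Poly k A) ∈ Poly.deg k A i)
    (hy : (y : Poly k A) ∈ Poly.deg k A j) :
    inc k A x * inc k A y = (-1) ^ (i * j) * (inc k A y * inc k A x) := by
  have h : proj k A _ = proj k A _ := RingQuot.mkAlgHom_rel R (SymRel.comm i j x y hx hy)
  rw [map_mul, map_mul, map_mul, map_pow, map_neg, map_one] at h
  exact h

theorem adjoin_range_inc : Algebra.adjoin R (Set.range (inc k A)) = ⊤ := by
  rw [eq_top_iff]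
  rintro s -
  obtain ⟨t, rfl⟩ : ∃ t, proj k A t = s := RingQuot.mkAlgHom_surjective R (SymRel k A) s
  induction t using TensorAlgebra.induction with
  | algebraMap f => rw [AlgHom.commutes]; exact Subalgebra.algebraMap_mem _ f
  | ι z => exact Algebra.subset_adjoin ⟨z, rfl⟩
  | mul a b ha hb => rw [map_mul]; exact mul_mem ha hb
  | add a b ha hb => rw [map_add]; exact add_mem ha hb

/-- The universal property of the graded symmetric algebra. -/
noncomputable def lift {B : Type*} [Ring B] [Algebra R B] (f : freeLie k A →ₗ[R] B)
    (hf : ∀ (i j : ℕ) (x y : freeLie k A), (x : Poly k A) ∈ Poly.deg k A i →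
      (y : Poly k A) ∈ Poly.deg k A j → f x * f y = (-1) ^ (i * j) * (f y * f x)) :
    Sym k A →ₐ[R] B :=
  RingQuot.liftAlgHom R ⟨TensorAlgebra.lift R f, by
    rintro _ _ ⟨i, j, x, y, hx, hy⟩
    simpa using hf i j x y hx hy⟩

theorem lift_inc {B : Type*} [Ring B] [Algebra R B] (f : freeLie k A →ₗ[R] B) (hf)
    (z : freeLie k A) : lift k A f hf (inc k A z) = f z := by
  have : lift k A f hf (inc k A z) = _ :=
    RingQuot.liftAlgHom_mkAlgHom_apply R _ _ (TensorAlgebra.ι R z)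
  rw [this, TensorAlgebra.lift_ι_apply]

/-- The elements of total degree `n`: the span of the products `z₁ ⊙ ⋯ ⊙ zₘ` of homogeneous
elements `zᵢ` of the free graded Lie algebra whose degrees add up to `n`. -/
noncomputable def deg (n : ℕ) : Submodule R (Sym k A) :=
  Submodule.span R {s | ∃ l : List (ℕ × freeLie k A),
    (∀ p ∈ l, (p.2 : Poly k A) ∈ Poly.deg k A p.1) ∧ (l.map Prod.fst).sum = n ∧
      (l.map fun p => inc k A p.2).prod = s}

theorem inc_mem {n : ℕ} {z : freeLie k A} (hz : (z : Poly k A) ∈ Poly.deg k A n) :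
    inc k A z ∈ deg k A n :=
  Submodule.subset_span ⟨[(n, z)], by simpa using hz, by simp, by simp⟩

theorem one_mem : (1 : Sym k A) ∈ deg k A 0 :=
  Submodule.subset_span ⟨[], by simp, by simp, by simp⟩

theorem mul_mem {i j : ℕ} {a b : Sym k A} (ha : a ∈ deg k A i) (hb : b ∈ deg k A j) :
    a * b ∈ deg k A (i + j) := by
  have h := Submodule.mul_mem_mul ha hb
  rw [deg, deg, Submodule.span_mul_span] at h
  refine Submodule.span_mono ?_ h
  rintro _ ⟨_, ⟨l, h1, h2, rfl⟩, _, ⟨l', h1', h2', rfl⟩, rfl⟩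
  refine ⟨l ++ l', ?_, ?_, ?_⟩
  · intro p hp
    rcases List.mem_append.1 hp with hp | hp
    exacts [h1 p hp, h1' p hp]
  · simp [h2, h2']
  · simp

/-- To prove a property of elements of total degree `n` it suffices to treat products. -/
theorem deg_induction {P : ℕ → Sym k A → Prop} (one : P 0 1)
    (add : ∀ (n : ℕ) a b, P n a → P n b → P n (a + b)) (zero : ∀ n, P n 0)
    (smul : ∀ (n : ℕ) (f : R) a, a ∈ deg k A n → P n a → P n (f • a))
    (mul : ∀ (i n : ℕ) (z : freeLie k A) a, (z : Poly k A) ∈ Poly.deg k A i → a ∈ deg k A n →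
      P n a → P (i + n) (inc k A z * a)) {n : ℕ} {a : Sym k A} (ha : a ∈ deg k A n) : P n a := by
  induction ha using Submodule.span_induction with
  | mem x h =>
    obtain ⟨l, h1, rfl, rfl⟩ := h
    induction l with
    | nil => exact one
    | cons p l ih =>
      simp only [List.map_cons, List.sum_cons, List.prod_cons]
      have h1' : ∀ q ∈ l, (q.2 : Poly k A) ∈ Poly.deg k A q.1 :=
        fun q hq => h1 q (List.mem_cons_of_mem _ hq)
      exact mul _ _ _ _ (h1 p List.mem_cons_self) (Submodule.subset_span ⟨l, h1', rfl, rfl⟩)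
        (ih h1')
  | zero => exact zero n
  | add x y _ _ hx hy => exact add _ _ _ hx hy
  | smul f x hx h => exact smul _ _ _ hx h

end Sym

/-- The flat `L`-connection on the free graded Lie algebra. -/
noncomputable def freeLie.conn : FlatConnection k R L (freeLie k A) :=
  (Poly.conn k A).restrict (freeLie k A) (fun x _ h => freeLie.conn_mem k A x h)

theorem freeLie.coe_conn (x : L) (z : freeLie k A) :
    ((freeLie.conn k A).nabla x z : Poly k A) = (Poly.conn k A).nabla x z := rfl

/-- The grade involution of the free graded Lie algebra. -/
noncomputable def freeLie.inv : freeLie k A →ₗ[R] freeLie k A :=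
  (Poly.inv k A).toLinearMap.restrict (fun _ h => freeLie.inv_mem k A h)

theorem freeLie.coe_inv (z : freeLie k A) :
    (freeLie.inv k A z : Poly k A) = Poly.inv k A z := rfl

theorem freeLie.inv_of_mem {n : ℕ} {z : freeLie k A} (hz : (z : Poly k A) ∈ Poly.deg k A n) :
    freeLie.inv k A z = (-1 : R) ^ n • z := by
  refine Subtype.ext ?_
  rw [freeLie.coe_inv, Poly.inv_of_mem k A hz]
  rcases Nat.even_or_odd n with h | h <;> simp [h.neg_one_pow]

namespace Sym

theorem dual_sign_mul (x : L) (n : ℕ) (a b : Sym k A) :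
    (-1) ^ n * Dual.mk (R := R) x a b = Dual.mk x ((-1) ^ n * a) ((-1) ^ n * b) := by
  rcases Nat.even_or_odd n with h | h
  · simp [h.neg_one_pow]
  · simp [h.neg_one_pow]; rfl

/-- The flat `L`-connection on the graded symmetric algebra: covariant derivatives act as
derivations. -/
noncomputable def conn : FlatConnection k R L (Sym k A) :=
  evenConn (freeLie.conn k A) (inc k A)
    (fun x => lift k A (Dual.lin (freeLie.conn k A) (inc k A) x) (by
      intro i j y z hy hz
      change Dual.mk x _ _ * Dual.mk x _ _ = _ * (Dual.mk x _ _ * Dual.mk x _ _)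
      have hy' := Poly.conn_mem k A x hy
      have hz' := Poly.conn_mem k A x hz
      rw [← freeLie.coe_conn] at hy' hz'
      rw [Dual.mk_mul, Dual.mk_mul, dual_sign_mul, inc_comm k A hy hz, inc_comm k A hy hz',
        inc_comm k A hy' hz, mul_add, add_comm]))
    (adjoin_range_inc k A) (fun _ _ => lift_inc k A _ _ _)

theorem conn_inc (x : L) (z : freeLie k A) :
    (conn k A).nabla x (inc k A z) = inc k A ((freeLie.conn k A).nabla x z) := evenConn_gen ..

theorem conn_alg (x : L) (f : R) :
    (conn k A).nabla x (algebraMap R _ f) = algebraMap R _ ⁅x, f⁆ := evenConn_alg ..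

theorem conn_mul (x : L) (a b : Sym k A) : (conn k A).nabla x (a * b) =
    a * (conn k A).nabla x b + (conn k A).nabla x a * b := evenConn_mul ..

theorem conn_mem (x : L) {n : ℕ} {a : Sym k A} (ha : a ∈ deg k A n) :
    (conn k A).nabla x a ∈ deg k A n := by
  refine deg_induction k A (P := fun n a => (conn k A).nabla x a ∈ deg k A n) ?_ ?_ ?_ ?_ ?_ ha
  · have := conn_alg k A x 1
    rw [map_one] at this
    rw [this, Algebra.algebraMap_eq_smul_one]
    exact Submodule.smul_mem _ _ (one_mem k A)
  · intro n a b ha hb; rw [map_add]; exact add_mem ha hb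
  · intro n; rw [map_zero]; exact zero_mem _
  · intro n f a ha h
    rw [(conn k A).leibniz]
    exact add_mem (Submodule.smul_mem _ _ h) (Submodule.smul_mem _ _ ha)
  · intro i n z a hz ha h
    rw [conn_mul, conn_inc]
    exact add_mem (mul_mem k A (inc_mem k A hz) h)
      (mul_mem k A (inc_mem k A (Poly.conn_mem k A x hz)) ha)

/-- The grade involution: multiplication by `(-1)^n` in total degree `n`. -/
noncomputable def inv : Sym k A →ₐ[R] Sym k A :=
  lift k A ((inc k A).comp (freeLie.inv k A)) (by
    intro i j x y hx hy
    simp only [LinearMap.comp_apply, freeLie.inv_of_mem k A hx, freeLie.inv_of_mem k A hy,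
      map_smul, smul_mul_assoc, mul_smul_comm, inc_comm k A hx hy]
    rw [smul_comm])

theorem inv_inc (z : freeLie k A) : inv k A (inc k A z) = inc k A (freeLie.inv k A z) :=
  lift_inc k A _ _ z

theorem inv_inc_of_mem {n : ℕ} {z : freeLie k A} (hz : (z : Poly k A) ∈ Poly.deg k A n) :
    inv k A (inc k A z) = (-1) ^ n * inc k A z := by
  rw [inv_inc, freeLie.inv_of_mem k A hz]
  rcases Nat.even_or_odd n with h | h <;> simp [h.neg_one_pow]

theorem inv_inv (a : Sym k A) : inv k A (inv k A a) = a := by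
  induction a using gen_induction (inc k A) (adjoin_range_inc k A) with
  | alg f => simp
  | gen z =>
    rw [inv_inc, inv_inc]
    congr 1
    exact Subtype.ext (Poly.inv_inv k A z)
  | mul a b ha hb => simp only [map_mul, ha, hb]
  | add a b ha hb => simp only [map_add, ha, hb]

end Sym

variable [CharZero k]

/-- The differential of the free graded Lie algebra. -/
noncomputable def freeLie.d : freeLie k A →ₗ[R] freeLie k A :=
  (Poly.d k A).restrict (fun _ h => freeLie.d_mem k A h)

theorem freeLie.coe_d (z : freeLie k A) : (freeLie.d k A z : Poly k A) = Poly.d k A z := rfl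

namespace Sym

theorem matrix_sign_mul (n : ℕ) (a b c : Sym k A) :
    (-1) ^ n * !![a, b; 0, c] = !![(-1) ^ n * a, (-1) ^ n * b; 0, (-1) ^ n * c] := by
  rcases Nat.even_or_odd n with h | h
  · simp [h.neg_one_pow]
  · simp [h.neg_one_pow, Matrix.neg_of]

theorem odd_comm_aux {B : Type*} [Ring B] {i j : ℕ} {x y x' y' : B}
    (h2 : x * y' = (-1) ^ (i * (j + 1)) * (y' * x))
    (h3 : x' * y = (-1) ^ ((i + 1) * j) * (y * x')) :
    (-1) ^ i * x * y' + x' * y = (-1) ^ (i * j) * ((-1) ^ j * y * x' + y' * x) := by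
  rw [mul_add, mul_one, pow_add] at h2
  rw [add_mul, one_mul, pow_add] at h3
  rw [mul_assoc, h2, h3, mul_add, add_comm]
  rcases neg_one_pow_eq_or B i with h | h <;>
  rcases neg_one_pow_eq_or B j with h' | h' <;>
  rcases neg_one_pow_eq_or B (i * j) with h'' | h'' <;>
  simp [h, h', h'']

theorem diag_comm_aux {B : Type*} [Ring B] {i j : ℕ} {x y : B}
    (h1 : x * y = (-1) ^ (i * j) * (y * x)) :
    (-1) ^ i * x * ((-1) ^ j * y) = (-1) ^ (i * j) * ((-1) ^ j * y * ((-1) ^ i * x)) := by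
  rcases neg_one_pow_eq_or B i with h | h <;>
  rcases neg_one_pow_eq_or B j with h' | h' <;>
  simp [h, h', h1]

/-- The algebra map `s ↦ [[inv s, d s], [0, s]]` that defines the differential. -/
noncomputable def dAux : Sym k A →ₐ[R] Matrix (Fin 2) (Fin 2) (Sym k A) :=
  lift k A (oddLin (inc k A) (inv k A) ((inc k A).comp (freeLie.d k A))) (by
    intro i j x y hx hy
    have hx' := Poly.d_mem k A hx
    have hy' := Poly.d_mem k A hy
    rw [← freeLie.coe_d] at hx' hy'
    have h1 := inc_comm k A hx hy
    have h2 := inc_comm k A hx hy'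
    have h3 := inc_comm k A hx' hy
    change !![inv k A (inc k A x), inc k A (freeLie.d k A x); 0, inc k A x] *
        !![inv k A (inc k A y), inc k A (freeLie.d k A y); 0, inc k A y] =
      (-1) ^ (i * j) * (!![inv k A (inc k A y), inc k A (freeLie.d k A y); 0, inc k A y] *
        !![inv k A (inc k A x), inc k A (freeLie.d k A x); 0, inc k A x])
    rw [inv_inc_of_mem k A hx, inv_inc_of_mem k A hy]
    rw [Matrix.mul_fin_two, Matrix.mul_fin_two]
    simp only [mul_zero, zero_mul, add_zero, zero_add]
    rw [matrix_sign_mul, ← h1, odd_comm_aux (i := i) (j := j) h2 h3, diag_comm_aux h1])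

/-- The differential on the graded symmetric algebra: the unique extension of the differential of
the free graded Lie algebra with `d (a ⊙ b) = d a ⊙ b + (-1)^|a| a ⊙ d b`. -/
noncomputable def d : Sym k A →ₗ[R] Sym k A := oddDer (dAux k A)

theorem d_alg (f : R) : d k A (algebraMap R _ f) = 0 := oddDer_alg _ f

theorem d_inc (z : freeLie k A) : d k A (inc k A z) = inc k A (freeLie.d k A z) :=
  oddDer_gen (inc k A) (inv k A) ((inc k A).comp (freeLie.d k A)) _
    (fun _ => lift_inc k A _ _ _) z

theorem d_mul (a b : Sym k A) : d k A (a * b) = d k A a * b + inv k A a * d k A b :=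
  oddDer_mul (inc k A) (inv k A) ((inc k A).comp (freeLie.d k A)) _ (adjoin_range_inc k A)
    (fun _ => lift_inc k A _ _ _) a b

theorem d_mem {n : ℕ} {a : Sym k A} (ha : a ∈ deg k A n) : d k A a ∈ deg k A (n + 1) := by
  refine deg_induction k A (P := fun n a => d k A a ∈ deg k A (n + 1)) ?_ ?_ ?_ ?_ ?_ ha
  · have := d_alg k A 1
    rw [map_one] at this
    rw [this]; exact zero_mem _
  · intro n a b ha hb; rw [map_add]; exact add_mem ha hb
  · intro n; rw [map_zero]; exact zero_mem _
  · intro n f a _ h; rw [map_smul]; exact Submodule.smul_mem _ _ h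
  · intro i n z a hz ha h
    rw [d_mul, d_inc, inv_inc, freeLie.inv_of_mem k A hz, map_smul, smul_mul_assoc]
    have h1 := mul_mem k A (inc_mem k A (z := freeLie.d k A z) (Poly.d_mem k A hz)) ha
    rw [show i + 1 + n = i + n + 1 by omega] at h1
    have h2 := mul_mem k A (inc_mem k A hz) h
    exact add_mem h1 (Submodule.smul_mem _ _ h2)

theorem inv_d (a : Sym k A) : inv k A (d k A a) = -d k A (inv k A a) := by
  induction a using gen_induction (inc k A) (adjoin_range_inc k A) with
  | alg f => simp [d_alg]
  | gen z =>
    rw [d_inc, inv_inc, inv_inc, d_inc, ← map_neg]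
    congr 1
    exact Subtype.ext (Poly.inv_d k A z)
  | mul a b ha hb => simp only [d_mul, map_add, map_mul, ha, hb]; noncomm_ring
  | add a b ha hb => simp only [map_add, ha, hb]; abel

theorem d_d (a : Sym k A) : d k A (d k A a) = 0 := by
  induction a using gen_induction (inc k A) (adjoin_range_inc k A) with
  | alg f => rw [d_alg, map_zero]
  | gen z =>
    rw [d_inc, d_inc, ← map_zero (inc k A)]
    congr 1
    exact Subtype.ext (Poly.d_d k A z)
  | mul a b ha hb => simp only [d_mul, map_add, inv_d, ha, hb, inv_inv]; noncomm_ring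
  | add a b ha hb => simp only [map_add, ha, hb, add_zero]

theorem inv_conn (x : L) (a : Sym k A) :
    inv k A ((conn k A).nabla x a) = (conn k A).nabla x (inv k A a) := by
  induction a using gen_induction (inc k A) (adjoin_range_inc k A) with
  | alg f => simp [conn_alg]
  | gen z =>
    rw [conn_inc, inv_inc, inv_inc, conn_inc]
    congr 1
    exact Subtype.ext (Poly.inv_conn k A x z)
  | mul a b ha hb => simp only [conn_mul, map_mul, map_add, ha, hb]
  | add a b ha hb => simp only [map_add, ha, hb]

theorem d_conn (x : A) (a : Sym k A) :
    d k A ((conn k A).nabla x a) = (conn k A).nabla x (d k A a) := by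
  induction a using gen_induction (inc k A) (adjoin_range_inc k A) with
  | alg f => simp [conn_alg, d_alg]
  | gen z =>
    rw [conn_inc, d_inc, d_inc, conn_inc]
    congr 1
    exact Subtype.ext (Poly.d_conn k A x z)
  | mul a b ha hb => simp only [conn_mul, d_mul, map_add, ha, hb, inv_conn]; abel
  | add a b ha hb => simp only [map_add, ha, hb]

end Sym

end Sym

section Complexes

/-- The cochain complex of `U(L)`-modules with terms `deg n ⊆ B` formed from a flat `L`-connection
and a differential on `B` that respect the grading and commute with each other. -/
noncomputable def complexOf {k : Type u} {R : Type v} {L : Type w} [Field k] [CommRing R]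
    [Algebra k R] [LieRing L] [LieAlgebra k L] [Module R L] [LieRingModule L R]
    [LieRinehartRing R L] [LieRinehartAlgebra k R L]
    {B : Type v'} [AddCommGroup B] [Module k B] [Module R B] [IsScalarTower k R B]
    (C : FlatConnection k R L B) (deg : ℕ → Submodule R B) (d : B →ₗ[R] B)
    (hC : ∀ n x, ∀ b ∈ deg n, C.nabla x b ∈ deg n) (hd : ∀ n, ∀ b ∈ deg n, d b ∈ deg (n + 1))
    (hdC : ∀ x b, d (C.nabla x b) = C.nabla x (d b)) (hdd : ∀ b, d (d b) = 0) :
    CochainComplex (ModuleCat.{v'} (Env k R L)) ℕ :=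
  CochainComplex.of (fun n => (C.restrict (deg n) (hC n)).toModuleCat)
    (fun n => FlatConnection.homOf _ _ (d.restrict (hd n)) (fun x b => Subtype.ext (hdC x b)))
    (fun n => by
      ext b
      exact Subtype.ext (hdd b.1))

variable (k : Type u) {R : Type v} {L : Type w} [Field k] [CommRing R] [Algebra k R]
  [LieRing L] [LieAlgebra k L] [Module R L] [LieRingModule L R] [LieRinehartRing R L]
  [LieRinehartAlgebra k R L] (A : LieRinehartSubalgebra R L)

/-- The complex of `A`-modules given by the tensor algebra of `U(L) / U(L) A` with the coboundary
operator `Poly.d`. -/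
noncomputable def polyComplex : CochainComplex (ModuleCat.{max u v w} (Env k R A)) ℕ :=
  complexOf ((Poly.conn k A).restrictTo A) (Poly.deg k A) (Poly.d k A)
    (fun _ x _ h => Poly.conn_mem k A x h) (fun _ _ h => Poly.d_mem k A h)
    (fun x b => Poly.d_conn k A x b) (Poly.d_d k A)

/-- The complex of `A`-modules given by the graded symmetric algebra of the free graded Lie algebra
generated by `U(L) / U(L) A`. -/
noncomputable def symComplex [CharZero k] :
    CochainComplex (ModuleCat.{max u v w} (Env k R A)) ℕ :=
  complexOf ((Sym.conn k A).restrictTo A) (Sym.deg k A) (Sym.d k A)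
    (fun _ x _ h => Sym.conn_mem k A x h) (fun _ _ h => Sym.d_mem k A h)
    (fun x b => Sym.d_conn k A x b) (Sym.d_d k A)

end Complexes

section Symmetrization

/-- The Koszul sign of the permutation `σ` of homogeneous elements of degrees `deg`: the product of
`(-1)^(deg (σ i) * deg (σ j))` over all `i < j` with `σ j < σ i`. -/
def koszulSign {n : ℕ} (deg : Fin n → ℕ) (σ : Equiv.Perm (Fin n)) : ℤ :=
  ∏ p : Fin n × Fin n with p.1 < p.2 ∧ σ p.2 < σ p.1, (-1) ^ (deg (σ p.1) * deg (σ p.2))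

variable (k : Type u) {R : Type v} {L : Type w} [Field k] [CommRing R] [Algebra k R]
  [LieRing L] [LieAlgebra k L] [Module R L] [LieRingModule L R] [LieRinehartRing R L]
  [LieRinehartAlgebra k R L] (A : LieRinehartSubalgebra R L)

/-- `I` is the symmetrization map: for homogeneous `z₁, …, zₙ` in the free graded Lie algebra,
`I (z₁ ⊙ ⋯ ⊙ zₙ)` is the average over all permutations `σ` of
`koszulSign σ • z_{σ 1} ⊗ ⋯ ⊗ z_{σ n}`. -/
def IsSymmetrization (I : Sym k A →ₗ[R] Poly k A) : Prop :=
  ∀ (n : ℕ) (deg : Fin n → ℕ) (z : Fin n → freeLie k A),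
    (∀ i, (z i : Poly k A) ∈ Poly.deg k A (deg i)) →
    I (List.ofFn fun i => Sym.inc k A (z i)).prod =
      (n.factorial : k)⁻¹ • ∑ σ : Equiv.Perm (Fin n),
        koszulSign deg σ • (List.ofFn fun i => (z (σ i) : Poly k A)).prod

end Symmetrization
end LiePair

/-! The theorem is a graded Poincaré–Birkhoff–Witt statement in its symmetrized form: the tensor
algebra `D` of `D¹` plays the role of the enveloping algebra of `L(D¹)`. Since `D¹` need not be free
over `R`, no basis is used; characteristic 0 replaces it.

Existence and uniqueness. Symmetrizing `n` factors amounts to choosing the first factor in all `n`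
ways, with its Koszul sign, and symmetrizing the others. Hence the component `symmN n` on products
of `n` factors is defined by recursion from `Sym.split`, which extracts one factor. As products span
`S(L(D¹))`, the formula determines the map.

Compatibility. `Sym.split` and the product of `D` commute with `d` and with the action of `L`, since
these are (graded) derivations on all algebras involved. The recursion passes this on to the
symmetrization (`Sym.symm_d`, `Sym.symm_conn`).

Surjectivity. Exchanging two neighbours in `z₁ ⊗ ⋯ ⊗ zₙ` costs a bracket, which is again a single
element of `L(D¹)`, so it costs only shorter products. Thus symmetrization is the identity modulo
shorter products (`Sym.symm_prodFn_sub_mem_filt`), and induction on the length applies.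

Injectivity. By Dynkin–Specht–Wever the iterated bracket operator acts on Lie elements of degree `n`
as multiplication by `n`; dividing by `n` gives a retraction `Poly.lieProj` of `D` onto `L(D¹)`. Lie
elements are primitive for the coproduct of `D`, so the `n`-fold convolution power `Poly.symbol n`
of this retraction, with values in `S(L(D¹))`, kills products of fewer than `n` Lie elements and
sends `z₁ ⊗ ⋯ ⊗ zₙ` to `n! z₁ ⊙ ⋯ ⊙ zₙ` (`Poly.symbol_prodFn`). It therefore inverts the
symmetrization on leading terms, up to the invertible factor `n!`. -/

namespace LiePair

universe u v w

/-! ### Generation by homogeneous elements -/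

section HomogeneousGeneration

variable (k : Type u) {R : Type v} {L : Type w} [Field k] [CommRing R] [Algebra k R]
  [LieRing L] [LieAlgebra k L] [Module R L] [LieRingModule L R] [LieRinehartRing R L]
  [LieRinehartAlgebra k R L] (A : LieRinehartSubalgebra R L)

/-- The free graded Lie algebra is spanned by its homogeneous elements. -/
theorem freeLie.le_iSup_deg : freeLie k A ≤ ⨆ n, freeLie k A ⊓ Poly.deg k A n := by
  refine freeLie.le_of k A _ (fun p => ?_) ?_
  · exact Submodule.mem_iSup_of_mem 1 ⟨freeLie.inc_mem k A p, Poly.inc_mem k A p⟩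
  · intro i j u v hi hj hu hv _ _
    refine Submodule.mem_iSup_of_mem (i + j) ⟨freeLie.bracket_mem k A hi hj hu hv, ?_⟩
    exact sub_mem (Poly.mul_mem k A hi hj)
      (freeLie.sign_mem k A _ (by rw [add_comm]; exact Poly.mul_mem k A hj hi))

theorem freeLie.hom_induction {P : freeLie k A → Prop}
    (hom : ∀ n (z : freeLie k A), (z : Poly k A) ∈ Poly.deg k A n → P z) (zero : P 0)
    (add : ∀ x y, P x → P y → P (x + y)) (z : freeLie k A) : P z := by
  obtain ⟨z, hz⟩ := z
  -- The induction runs in the ambient tensor algebra, so the motive has to carry the membership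
  -- proof.
  have key : ∃ h : z ∈ freeLie k A, P ⟨z, h⟩ := by
    refine Submodule.iSup_induction (fun n => freeLie k A ⊓ Poly.deg k A n)
      (motive := fun z => ∃ h : z ∈ freeLie k A, P ⟨z, h⟩) (freeLie.le_iSup_deg k A hz) ?_ ?_ ?_
    · rintro n x ⟨h1, h2⟩
      exact ⟨h1, hom n _ h2⟩
    · exact ⟨zero_mem _, zero⟩
    · rintro x y ⟨hx, px⟩ ⟨hy, py⟩
      exact ⟨add_mem hx hy, add _ _ px py⟩
  exact key.2

/-- The graded symmetric algebra is spanned by products of homogeneous elements of the free graded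
Lie algebra. -/
theorem Sym.hom_induction {P : Sym k A → Prop} (one : P 1)
    (add : ∀ a b, P a → P b → P (a + b)) (smul : ∀ (f : R) a, P a → P (f • a))
    (mul : ∀ (i : ℕ) (z : freeLie k A) a, (z : Poly k A) ∈ Poly.deg k A i → P a →
      P (inc k A z * a)) (a : Sym k A) : P a := by
  -- Closure under left multiplication by every `b` is multiplicative in `b`, so it suffices to
  -- check it on generators; `a = 1` then gives the claim.
  have key : ∀ b a, P a → P (b * a) := by
    intro b
    induction b using gen_induction (inc k A) (adjoin_range_inc k A) with
    | alg f => intro a ha; rw [← Algebra.smul_def]; exact smul f a ha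
    | gen z =>
      intro a ha
      induction z using freeLie.hom_induction k A with
      | hom n z hz => exact mul n z a hz ha
      | zero => simpa using smul 0 a ha
      | add x y hx hy => rw [map_add, add_mul]; exact add _ _ hx hy
    | mul b c hb hc => intro a ha; rw [mul_assoc]; exact hb _ (hc _ ha)
    | add b c hb hc => intro a ha; rw [add_mul]; exact add _ _ (hb _ ha) (hc _ ha)
  simpa using key a 1 one

end HomogeneousGeneration

/-! ### Linear maps out of the graded symmetric algebra defined by recursion -/

section RecursiveMaps

theorem neg_one_pow_mul_eq_smul (R : Type*) {B : Type*} [CommRing R] [Ring B] [Algebra R B] (n : ℕ)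
    (b : B) : (-1) ^ n * b = (-1 : R) ^ n • b := by
  rcases Nat.even_or_odd n with h | h <;> simp [h.neg_one_pow]

variable {k : Type u} {R : Type v} {L : Type w} [Field k] [CommRing R] [Algebra k R]
  [LieRing L] [LieAlgebra k L] [Module R L] [LieRingModule L R] [LieRinehartRing R L]
  [LieRinehartAlgebra k R L] {A : LieRinehartSubalgebra R L}
  {W : Type*} [AddCommGroup W] [Module R W]

/-- The operator `(s, w) ↦ (z ⊙ s, a z s + κ z w)`. -/
noncomputable def Sym.recGen (a : freeLie k A →ₗ[R] Sym k A →ₗ[R] W)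
    (κ : freeLie k A →ₗ[R] Module.End R W) : freeLie k A →ₗ[R] Module.End R (Sym k A × W) where
  toFun z := LinearMap.prod ((LinearMap.mulLeft R (Sym.inc k A z)).comp (LinearMap.fst R _ _))
    ((a z).comp (LinearMap.fst R _ _) + (κ z).comp (LinearMap.snd R _ _))
  map_add' x y := by
    refine LinearMap.ext fun p => Prod.ext ?_ ?_
    · simp [add_mul]
    · simp; abel
  map_smul' f x := by
    refine LinearMap.ext fun p => Prod.ext ?_ ?_ <;> simp

theorem Sym.recGen_apply (a : freeLie k A →ₗ[R] Sym k A →ₗ[R] W)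
    (κ : freeLie k A →ₗ[R] Module.End R W) (z : freeLie k A) (p) :
    recGen a κ z p = (inc k A z * p.1, a z p.1 + κ z p.2) := rfl

variable (a : freeLie k A →ₗ[R] Sym k A →ₗ[R] W) (κ : freeLie k A →ₗ[R] Module.End R W)
  (hκ : ∀ (i j : ℕ) (x y : freeLie k A), (x : Poly k A) ∈ Poly.deg k A i →
    (y : Poly k A) ∈ Poly.deg k A j → ∀ w, κ x (κ y w) = (-1 : R) ^ (i * j) • κ y (κ x w))
  (ha : ∀ (i j : ℕ) (x y : freeLie k A), (x : Poly k A) ∈ Poly.deg k A i →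
    (y : Poly k A) ∈ Poly.deg k A j → ∀ s, a x (Sym.inc k A y * s) + κ x (a y s) =
      (-1 : R) ^ (i * j) • (a y (Sym.inc k A x * s) + κ y (a x s)))

/-- The algebra map that defines `recLift`. -/
noncomputable def Sym.recHom : Sym k A →ₐ[R] Module.End R (Sym k A × W) :=
  lift k A (recGen a κ) (fun i j x y hx hy => by
    -- The operators have to commute up to the Koszul sign, so that the recursion does not depend on
    -- the order of the factors. The first coordinate is the relation of the graded symmetric
    -- algebra, the second one is the sum of `ha` and `hκ`.
    refine Eq.trans ?_ (neg_one_pow_mul_eq_smul R (i * j) _).symm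
    refine LinearMap.ext fun p => Prod.ext ?_ ?_
    · simp only [Module.End.mul_apply, LinearMap.smul_apply, recGen_apply, Prod.smul_fst]
      rw [← mul_assoc, ← mul_assoc, inc_comm k A hx hy]
      rcases Nat.even_or_odd (i * j) with h | h <;> simp [h.neg_one_pow]
    · simp only [Module.End.mul_apply, LinearMap.smul_apply, recGen_apply, Prod.smul_snd, map_add]
      rw [← add_assoc, ha i j x y hx hy, hκ i j x y hx hy, ← smul_add, add_assoc])

/-- Started at `(1, 0)`, the first coordinate remembers `s` itself. This is what lets the second
coordinate use `s` in the term `a z s` of the recursion. -/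
theorem Sym.recHom_fst (s : Sym k A) : ∀ p, (recHom a κ hκ ha s p).1 = s * p.1 := by
  induction s using gen_induction (inc k A) (adjoin_range_inc k A) with
  | alg f => intro p; simp [Algebra.smul_def]
  | gen z => intro p; rw [recHom, lift_inc]; rfl
  | mul a b ha hb => intro p; rw [map_mul, Module.End.mul_apply, ha, hb, mul_assoc]
  | add a b ha hb => intro p; simp [ha, hb, add_mul]

/-- The linear map `F` on the graded symmetric algebra with `F 1 = 0` and
`F (z ⊙ s) = a z s + κ z (F s)`. -/
noncomputable def Sym.recLift : Sym k A →ₗ[R] W :=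
  (LinearMap.snd R _ _).comp ((recHom a κ hκ ha).toLinearMap.flip (1, 0))

theorem Sym.recLift_alg (f : R) : recLift a κ hκ ha (algebraMap R _ f) = 0 := by
  change (recHom a κ hκ ha (algebraMap R _ f) (1, 0)).2 = 0
  simp

theorem Sym.recLift_mul (z : freeLie k A) (s : Sym k A) :
    recLift a κ hκ ha (inc k A z * s) = a z s + κ z (recLift a κ hκ ha s) := by
  change (recHom a κ hκ ha (inc k A z * s) (1, 0)).2 = _
  rw [map_mul, Module.End.mul_apply, recHom, lift_inc, recGen_apply, ← recHom,
    recHom_fst a κ hκ ha, mul_one]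
  rfl

end RecursiveMaps

/-! ### Extracting one factor from a product -/

section Splitting

variable (k : Type u) {R : Type v} {L : Type w} [Field k] [CommRing R] [Algebra k R]
  [LieRing L] [LieAlgebra k L] [Module R L] [LieRingModule L R] [LieRinehartRing R L]
  [LieRinehartAlgebra k R L] (A : LieRinehartSubalgebra R L)

/-- The image in `R` of the inverse of `n` in `k`. -/
def invNat (R : Type v) [CommRing R] [Algebra k R] (n : ℕ) : R := algebraMap k R (n : k)⁻¹

theorem invNat_smul {M : Type*} [AddCommGroup M] [Module k M] [Module R M] [IsScalarTower k R M]
    (n : ℕ) (m : M) : invNat k R n • m = (n : k)⁻¹ • m := algebraMap_smul R _ m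

theorem natCast_mul_invNat [CharZero k] {n : ℕ} (hn : n ≠ 0) : (n : R) * invNat k R n = 1 := by
  rw [invNat, ← map_natCast (algebraMap k R), ← map_mul, mul_inv_cancel₀ (by exact_mod_cast hn),
    map_one]

/-- The part of even degree of an element of the free graded Lie algebra. -/
noncomputable def freeLie.evenPart : freeLie k A →ₗ[R] freeLie k A :=
  invNat k R 2 • (LinearMap.id + freeLie.inv k A)

/-- The part of odd degree of an element of the free graded Lie algebra. -/
noncomputable def freeLie.oddPart : freeLie k A →ₗ[R] freeLie k A :=
  invNat k R 2 • (LinearMap.id - freeLie.inv k A)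

/-- Left multiplication by `z` on the second factor of `D ⊗ S(L(D¹))`, with the Koszul sign:
`y ⊗ s ↦ (-1)^(|z| |y|) y ⊗ (z ⊙ s)`. -/
noncomputable def Sym.rightMul : freeLie k A →ₗ[R] Module.End R (Poly k A ⊗[R] Sym k A) :=
  (TensorProduct.mapBilinear (RingHom.id R) _ _ _ _ LinearMap.id).comp
      ((LinearMap.mul R (Sym k A)).comp ((Sym.inc k A).comp (freeLie.evenPart k A))) +
    (TensorProduct.mapBilinear (RingHom.id R) _ _ _ _ (Poly.inv k A).toLinearMap).comp
      ((LinearMap.mul R (Sym k A)).comp ((Sym.inc k A).comp (freeLie.oddPart k A)))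

/-- The `i`-th iterate of the grade involution encodes the Koszul sign of moving an element of
degree `i` past `y`, in a form that makes sense for inhomogeneous `y` as well. -/
theorem Poly.iterate_inv_of_mem {i j : ℕ} {y : Poly k A} (hy : y ∈ Poly.deg k A j) :
    (inv k A)^[i] y = (-1 : R) ^ (i * j) • y := by
  induction i with
  | zero => simp
  | succ i ih =>
    rw [Function.iterate_succ_apply', ih, map_smul, inv_of_mem k A hy]
    rcases Nat.even_or_odd j with h | h <;>
    rcases Nat.even_or_odd (i * j) with h' | h' <;>
    simp [h.neg_one_pow, h'.neg_one_pow, add_mul, pow_add]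

theorem Poly.iterate_inv {i : ℕ} (y : Poly k A) :
    (inv k A)^[i] y = if Even i then y else inv k A y := by
  induction i with
  | zero => simp
  | succ i ih =>
    rw [Function.iterate_succ_apply', ih]
    by_cases h : Even i <;> simp [h, Nat.even_add_one, inv_inv]

variable [CharZero k]

theorem invNat_two_add : invNat k R 2 + invNat k R 2 = 1 := by
  have := natCast_mul_invNat k (R := R) (n := 2) two_ne_zero
  rw [← this]; push_cast; ring

theorem freeLie.evenPart_of_mem {i : ℕ} {z : freeLie k A}
    (hz : (z : Poly k A) ∈ Poly.deg k A i) : evenPart k A z = if Even i then z else 0 := by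
  rcases Nat.even_or_odd i with h | h
  · simp [evenPart, inv_of_mem k A hz, h, ← add_smul, invNat_two_add]
  · have h' : ¬ Even i := by simpa using h
    have h1 := neg_one_smul R z
    have h2 := add_neg_cancel z
    simp only [evenPart, LinearMap.smul_apply, LinearMap.add_apply, inv_of_mem k A hz,
      h.neg_one_pow, LinearMap.id_apply, h1, h2, smul_zero, h', if_false]

theorem freeLie.oddPart_of_mem {i : ℕ} {z : freeLie k A}
    (hz : (z : Poly k A) ∈ Poly.deg k A i) : oddPart k A z = if Even i then 0 else z := by
  rcases Nat.even_or_odd i with h | h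
  · simp [oddPart, inv_of_mem k A hz, h]
  · have h' : ¬ Even i := by simpa using h
    have h1 := neg_one_smul R z
    have h2 := sub_neg_eq_add z z
    simp only [oddPart, LinearMap.smul_apply, LinearMap.sub_apply, inv_of_mem k A hz,
      h.neg_one_pow, LinearMap.id_apply, h1, h2, smul_add, ← add_smul, invNat_two_add, one_smul,
      h', if_false]

/-- The sign depends only on the parity of `|z|`, so the decomposition into even and odd parts makes
it linear in `z`; for homogeneous `z` one of the two parts vanishes. -/
theorem Sym.rightMul_tmul {i : ℕ} {z : freeLie k A} (hz : (z : Poly k A) ∈ Poly.deg k A i)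
    (y : Poly k A) (s : Sym k A) :
    rightMul k A z (y ⊗ₜ[R] s) = (Poly.inv k A)^[i] y ⊗ₜ[R] (inc k A z * s) := by
  rw [Poly.iterate_inv]
  have : rightMul k A z (y ⊗ₜ[R] s) = y ⊗ₜ[R] (inc k A (freeLie.evenPart k A z) * s) +
    Poly.inv k A y ⊗ₜ[R] (inc k A (freeLie.oddPart k A z) * s) := rfl
  rw [this, freeLie.evenPart_of_mem k A hz, freeLie.oddPart_of_mem k A hz]
  by_cases h : Even i <;> simp [h]

/-- Iterates of the involution on the left factor commute, so only the exchange of `x` and `y` in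
the right factor produces a sign. -/
theorem Sym.rightMul_comm {i j : ℕ} {x y : freeLie k A} (hx : (x : Poly k A) ∈ Poly.deg k A i)
    (hy : (y : Poly k A) ∈ Poly.deg k A j) (w) :
    rightMul k A x (rightMul k A y w) = (-1 : R) ^ (i * j) • rightMul k A y (rightMul k A x w) := by
  induction w with
  | zero => simp
  | add a b ha hb => simp only [map_add, smul_add, ha, hb]
  | tmul z s =>
    rw [rightMul_tmul k A hy, rightMul_tmul k A hx, rightMul_tmul k A hx, rightMul_tmul k A hy,
      ← Function.iterate_add_apply, ← Function.iterate_add_apply, add_comm j i, ← mul_assoc,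
      inc_comm k A hx hy, mul_assoc, ← mul_assoc (inc k A y), ← TensorProduct.tmul_smul]
    congr 1
    rcases Nat.even_or_odd (i * j) with h | h <;> simp [h.neg_one_pow, mul_assoc]

/-- The component `S(L(D¹)) → D ⊗ S(L(D¹))` of the comultiplication, which sends
`z₁ ⊙ ⋯ ⊙ zₙ` to the sum of the `± zᵢ ⊗ (z₁ ⊙ ⋯ ẑᵢ ⋯ ⊙ zₙ)`. -/
noncomputable def Sym.split : Sym k A →ₗ[R] Poly k A ⊗[R] Sym k A :=
  recLift (W := Poly k A ⊗[R] Sym k A)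
    ((TensorProduct.mk R (Poly k A) (Sym k A)).comp (freeLie k A).subtype) (rightMul k A)
    (fun _ _ _ _ hx hy w => rightMul_comm k A hx hy w)
    (fun i j x y hx hy s => by
      change (x : Poly k A) ⊗ₜ[R] (inc k A y * s) + rightMul k A x ((y : Poly k A) ⊗ₜ[R] s) =
        (-1 : R) ^ (i * j) • ((y : Poly k A) ⊗ₜ[R] (inc k A x * s) +
          rightMul k A y ((x : Poly k A) ⊗ₜ[R] s))
      -- Moving `x` past `y` and moving `y` past `x` give the same sign, whose square is 1; the two
      -- sides then differ only in the order of the summands.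
      rw [rightMul_tmul k A hx, rightMul_tmul k A hy, Poly.iterate_inv_of_mem k A hy,
        Poly.iterate_inv_of_mem k A hx, mul_comm j i, ← TensorProduct.smul_tmul',
        ← TensorProduct.smul_tmul', smul_add, smul_smul, ← pow_add,
        Even.neg_one_pow ⟨i * j, rfl⟩, one_smul]
      exact add_comm _ _)

theorem Sym.split_alg (f : R) : split k A (algebraMap R _ f) = 0 := recLift_alg ..

theorem Sym.split_one : split k A 1 = 0 := by
  rw [← map_one (algebraMap R (Sym k A)), split_alg]

theorem Sym.split_mul (z : freeLie k A) (s : Sym k A) :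
    split k A (inc k A z * s) = (z : Poly k A) ⊗ₜ[R] s + rightMul k A z (split k A s) :=
  recLift_mul ..

end Splitting

/-! ### Koszul signs and permutations sorted by their first value -/

section KoszulSigns

/-- The Koszul sign of moving the `i`-th of several homogeneous elements to the front. -/
def moveSign {n : ℕ} (deg : Fin n → ℕ) (i : Fin n) : ℤ :=
  ∏ j : Fin n, if j < i then (-1) ^ (deg i * deg j) else 1

theorem moveSign_zero {n : ℕ} (deg : Fin (n + 1) → ℕ) : moveSign deg 0 = 1 := by
  simp [moveSign]

/-- The factor is moved to the place directly behind the factor `0` and then past it. -/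
theorem moveSign_succ {n : ℕ} (deg : Fin (n + 1) → ℕ) (i : Fin n) :
    moveSign deg i.succ = (-1) ^ (deg 0 * deg i.succ) * moveSign (fun j => deg j.succ) i := by
  simp [moveSign, Fin.prod_univ_succ, mul_comm (deg 0)]

/-- The permutation that sends `0` to `i` and the other indices, through `τ`, to the others. -/
def insertPerm {n : ℕ} (i : Fin (n + 1)) (τ : Equiv.Perm (Fin n)) : Equiv.Perm (Fin (n + 1)) :=
  (finSuccEquiv n).trans ((Equiv.optionCongr τ).trans (finSuccEquiv' i).symm)

theorem insertPerm_zero {n : ℕ} (i : Fin (n + 1)) (τ : Equiv.Perm (Fin n)) :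
    insertPerm i τ 0 = i := by
  simp [insertPerm]

theorem insertPerm_succ {n : ℕ} (i : Fin (n + 1)) (τ : Equiv.Perm (Fin n)) (j : Fin n) :
    insertPerm i τ j.succ = i.succAbove (τ j) := by
  simp [insertPerm]

theorem insertPerm_bijective (n : ℕ) :
    Function.Bijective fun p : Fin (n + 1) × Equiv.Perm (Fin n) => insertPerm p.1 p.2 := by
  rw [Fintype.bijective_iff_injective_and_card]
  constructor
  · rintro ⟨i, τ⟩ ⟨i', τ'⟩ h
    have h0 : i = i' := by
      rw [← insertPerm_zero i τ, ← insertPerm_zero i' τ']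
      exact DFunLike.congr_fun h 0
    subst h0
    congr 1
    ext j : 1
    have := DFunLike.congr_fun h j.succ
    simpa only [insertPerm_succ, Fin.succAbove_right_inj] using this
  · simp [Fintype.card_perm, Nat.factorial_succ]

/-- Groups the permutations by their value at `0`, to match the recursion in which the first factor
is chosen before the rest. -/
theorem sum_perm_succ {M : Type*} [AddCommMonoid M] {n : ℕ}
    (f : Equiv.Perm (Fin (n + 1)) → M) :
    ∑ σ, f σ = ∑ i, ∑ τ : Equiv.Perm (Fin n), f (insertPerm i τ) := by
  rw [← Fintype.sum_prod_type']
  exact ((insertPerm_bijective n).sum_comp f).symm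

/-- The inversions that involve position `0` pair `i` with the indices below it and give `moveSign`.
The remaining ones are those of `τ`, because `succAbove` is strictly increasing. -/
theorem koszulSign_insertPerm {n : ℕ} (deg : Fin (n + 1) → ℕ) (i : Fin (n + 1))
    (τ : Equiv.Perm (Fin n)) : koszulSign deg (insertPerm i τ) =
      moveSign deg i * koszulSign (fun j => deg (i.succAbove j)) τ := by
  simp only [koszulSign, Finset.prod_filter, Fintype.prod_prod_type, Fin.prod_univ_succ,
    insertPerm_zero, insertPerm_succ, false_and, if_false, one_mul, Fin.succ_pos,
    true_and, Fin.not_lt_zero, Fin.succ_lt_succ_iff, Fin.succAbove_lt_succAbove_iff]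
  congr 1
  rw [moveSign, Fin.prod_univ_succAbove _ i]
  simp only [lt_irrefl, if_false, one_mul]
  -- Position `j + 1` carries the index `i.succAbove (τ j)`; the product over positions becomes one
  -- over indices.
  exact Equiv.prod_comp τ
    (fun j => if i.succAbove j < i then (-1 : ℤ) ^ (deg i * deg (i.succAbove j)) else 1)

theorem neg_one_pow_zsmul (R : Type*) {M : Type*} [CommRing R] [AddCommGroup M] [Module R M]
    (n : ℕ) (m : M) : ((-1 : ℤ) ^ n) • m = (-1 : R) ^ n • m := by
  rcases Nat.even_or_odd n with h | h <;> simp [h.neg_one_pow]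

end KoszulSigns

/-! ### Construction and uniqueness of the symmetrization map -/

section SymmetrizationMap

variable (k : Type u) {R : Type v} {L : Type w} [Field k] [CommRing R] [Algebra k R]
  [LieRing L] [LieAlgebra k L] [Module R L] [LieRingModule L R] [LieRinehartRing R L]
  [LieRinehartAlgebra k R L] (A : LieRinehartSubalgebra R L)

/-- The product `z₁ ⊙ ⋯ ⊙ zₙ`. -/
noncomputable def Sym.prodFn {n : ℕ} (z : Fin n → freeLie k A) : Sym k A :=
  (List.ofFn fun i => inc k A (z i)).prod

theorem Sym.prodFn_zero (z : Fin 0 → freeLie k A) : prodFn k A z = 1 := by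
  simp [prodFn]

theorem Sym.prodFn_succ {n : ℕ} (z : Fin (n + 1) → freeLie k A) :
    prodFn k A z = inc k A (z 0) * prodFn k A (fun i => z i.succ) := by
  simp [prodFn, List.ofFn_succ]

/-- The product `z₁ ⊗ ⋯ ⊗ zₙ`. -/
noncomputable def Poly.prodFn {n : ℕ} (z : Fin n → freeLie k A) : Poly k A :=
  (List.ofFn fun i => (z i : Poly k A)).prod

theorem Poly.prodFn_zero (z : Fin 0 → freeLie k A) : prodFn k A z = 1 := by
  simp [prodFn]

theorem Poly.prodFn_succ {n : ℕ} (z : Fin (n + 1) → freeLie k A) :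
    prodFn k A z = z 0 * prodFn k A (fun i => z i.succ) := by
  simp [prodFn, List.ofFn_succ]

theorem Sym.mem_span_prodFn (s : Sym k A) :
    s ∈ Submodule.span R {s | ∃ (n : ℕ) (deg : Fin n → ℕ) (z : Fin n → freeLie k A),
      (∀ i, (z i : Poly k A) ∈ Poly.deg k A (deg i)) ∧ prodFn k A z = s} := by
  induction s using hom_induction k A with
  | one => exact Submodule.subset_span ⟨0, Fin.elim0, Fin.elim0, fun i => i.elim0, prodFn_zero ..⟩
  | add a b ha hb => exact add_mem ha hb
  | smul f a ha => exact Submodule.smul_mem _ f ha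
  | mul i z a hz ha =>
    induction ha using Submodule.span_induction with
    | mem x h =>
      obtain ⟨n, deg, y, hy, rfl⟩ := h
      refine Submodule.subset_span
        ⟨n + 1, Fin.cons i deg, Fin.cons z y, Fin.cases hz fun j => hy j, ?_⟩
      rw [prodFn_succ]; rfl
    | zero => simp
    | add x y _ _ hx hy => rw [mul_add]; exact add_mem hx hy
    | smul f x _ hx => rw [mul_smul_comm]; exact Submodule.smul_mem _ _ hx

/-- Unlike `Sym.hom_induction`, this keeps hold of the number of factors, on which `symmN` depends.
-/
theorem Sym.prod_induction {P : Sym k A → Prop}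
    (prod : ∀ (n : ℕ) (deg : Fin n → ℕ) (z : Fin n → freeLie k A),
      (∀ i, (z i : Poly k A) ∈ Poly.deg k A (deg i)) → P (prodFn k A z)) (zero : P 0)
    (add : ∀ a b, P a → P b → P (a + b)) (smul : ∀ (f : R) a, P a → P (f • a))
    (s : Sym k A) : P s := by
  induction mem_span_prodFn k A s using Submodule.span_induction with
  | mem x h => obtain ⟨n, deg, z, hz, rfl⟩ := h; exact prod n deg z hz
  | zero => exact zero
  | add x y _ _ hx hy => exact add _ _ hx hy
  | smul f x _ hx => exact smul _ _ hx

/-- The augmentation `S(L(D¹)) → R ⊆ D`. -/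
noncomputable def Sym.aug : Sym k A →ₗ[R] Poly k A :=
  (Algebra.linearMap R (Poly k A)).comp (lift k A (0 : freeLie k A →ₗ[R] R) (by simp)).toLinearMap

theorem Sym.aug_alg (f : R) : aug k A (algebraMap R _ f) = algebraMap R _ f := by
  simp [aug]

theorem Sym.aug_inc_mul (z : freeLie k A) (s : Sym k A) : aug k A (inc k A z * s) = 0 := by
  simp [aug, lift_inc]

variable [CharZero k]

/-- Either `z 0` itself is extracted, without sign, or a later factor is extracted and then passes
`z 0`; the sign of this passage is the one in `moveSign_succ`. -/
theorem Sym.split_prodFn {n : ℕ} (deg : Fin (n + 1) → ℕ) (z : Fin (n + 1) → freeLie k A)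
    (hz : ∀ i, (z i : Poly k A) ∈ Poly.deg k A (deg i)) :
    split k A (prodFn k A z) = ∑ i, moveSign deg i •
      ((z i : Poly k A) ⊗ₜ[R] prodFn k A (fun j => z (i.succAbove j))) := by
  induction n with
  | zero =>
    rw [prodFn_succ, split_mul, prodFn_zero, split_one, map_zero, add_zero, Fin.sum_univ_one,
      moveSign_zero, one_smul, prodFn_zero]
  | succ n ih =>
    rw [prodFn_succ, split_mul, ih (fun i => deg i.succ) _ (fun i => hz i.succ),
      Fin.sum_univ_succ (n := n + 1), moveSign_zero, one_smul, map_sum]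
    congr 1
    refine Finset.sum_congr rfl fun i _ => ?_
    rw [map_zsmul, rightMul_tmul k A (hz 0), Poly.iterate_inv_of_mem k A (hz i.succ),
      ← neg_one_pow_zsmul R, ← TensorProduct.smul_tmul', smul_smul, moveSign_succ, mul_comm]
    congr 2
    rw [prodFn_succ]
    simp

/-- The component of the symmetrization map on products of `n` elements. -/
noncomputable def Sym.symmN : ℕ → (Sym k A →ₗ[R] Poly k A)
  | 0 => aug k A
  | n + 1 => invNat k R (n + 1) •
      ((LinearMap.mul' R (Poly k A)).comp ((symmN n).lTensor (Poly k A))).comp (split k A)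

theorem Sym.symmN_succ_apply (n : ℕ) (s : Sym k A) : symmN k A (n + 1) s = invNat k R (n + 1) •
    LinearMap.mul' R (Poly k A) ((symmN k A n).lTensor (Poly k A) (split k A s)) := rfl

theorem Sym.symmN_one (n : ℕ) : symmN k A (n + 1) 1 = 0 := by
  simp [symmN_succ_apply, split_one]

theorem Sym.symmN_prodFn_succ (n : ℕ) {m : ℕ} (deg : Fin (m + 1) → ℕ)
    (z : Fin (m + 1) → freeLie k A) (hz : ∀ i, (z i : Poly k A) ∈ Poly.deg k A (deg i)) :
    symmN k A (n + 1) (prodFn k A z) = invNat k R (n + 1) • ∑ i, moveSign deg i •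
      ((z i : Poly k A) * symmN k A n (prodFn k A (fun j => z (i.succAbove j)))) := by
  rw [symmN_succ_apply, split_prodFn k A deg z hz]
  simp only [map_sum, map_zsmul, LinearMap.lTensor_tmul, LinearMap.mul'_apply]

/-- Each application of `split` removes one factor, and the final augmentation accepts only the
empty product; so only products of exactly `n` factors survive. -/
theorem Sym.symmN_of_ne {n m : ℕ} (h : n ≠ m) (deg : Fin m → ℕ) (z : Fin m → freeLie k A)
    (hz : ∀ i, (z i : Poly k A) ∈ Poly.deg k A (deg i)) : symmN k A n (prodFn k A z) = 0 := by
  induction n generalizing m with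
  | zero =>
    obtain ⟨m, rfl⟩ : ∃ m', m = m' + 1 := ⟨m - 1, by omega⟩
    rw [prodFn_succ]; exact aug_inc_mul ..
  | succ n ih =>
    cases m with
    | zero => rw [prodFn_zero, symmN_one]
    | succ m =>
      rw [symmN_prodFn_succ k A n deg z hz, Finset.sum_eq_zero, smul_zero]
      intro i _
      rw [ih (by omega) _ _ (fun j => hz _), mul_zero, smul_zero]

/-- The recursion and the average over permutations agree once permutations are sorted by their
first value: the signs multiply by `koszulSign_insertPerm`, the scalars by `(n + 1)! = (n + 1) n!`.
-/
theorem Sym.symmN_prodFn {n : ℕ} (deg : Fin n → ℕ) (z : Fin n → freeLie k A)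
    (hz : ∀ i, (z i : Poly k A) ∈ Poly.deg k A (deg i)) :
    symmN k A n (prodFn k A z) = (n.factorial : k)⁻¹ • ∑ σ : Equiv.Perm (Fin n),
      koszulSign deg σ • Poly.prodFn k A (fun i => z (σ i)) := by
  induction n with
  | zero =>
    have h := aug_alg k A 1
    rw [map_one (algebraMap R (Sym k A)), map_one (algebraMap R (Poly k A))] at h
    rw [prodFn_zero, symmN, h, Fintype.sum_unique, Poly.prodFn_zero]
    simp [koszulSign]
  | succ n ih =>
    rw [symmN_prodFn_succ k A n deg z hz, sum_perm_succ, invNat_smul, Nat.factorial_succ,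
      Nat.cast_mul, mul_inv, mul_smul]
    congr 1
    rw [Finset.smul_sum]
    refine Finset.sum_congr rfl fun i _ => ?_
    rw [ih _ _ (fun j => hz _), mul_smul_comm, smul_comm, Finset.mul_sum, Finset.smul_sum]
    congr 1
    refine Finset.sum_congr rfl fun τ _ => ?_
    rw [koszulSign_insertPerm, mul_smul, mul_smul_comm, Poly.prodFn_succ]
    simp only [insertPerm_zero, insertPerm_succ]

/-- Makes the sum of all `symmN n` meaningful and additive without decomposing the graded symmetric
algebra by number of factors: on a product at most one term is nonzero. -/
theorem Sym.symmN_finite (s : Sym k A) : (Function.support fun n => symmN k A n s).Finite := by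
  induction s using prod_induction k A with
  | prod n deg z hz =>
    refine (Set.finite_singleton n).subset fun m hm => ?_
    by_contra h
    exact hm (symmN_of_ne k A h deg z hz)
  | zero => simp
  | add a b ha hb =>
    refine (ha.union hb).subset ?_
    simp only [map_add]
    exact Function.support_add _ _
  | smul f a ha =>
    refine ha.subset ?_
    simp only [map_smul]
    exact Function.support_const_smul_subset f _

/-- The symmetrization map. -/
noncomputable def Sym.symm : Sym k A →ₗ[R] Poly k A where
  toFun s := ∑ᶠ n, symmN k A n s
  map_add' a b := by
    simp only [map_add]
    exact finsum_add_distrib (symmN_finite k A a) (symmN_finite k A b)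
  map_smul' f a := by
    simp only [map_smul, RingHom.id_apply]
    exact (smul_finsum' f (symmN_finite k A a)).symm

theorem Sym.symm_apply (s : Sym k A) : symm k A s = ∑ᶠ n, symmN k A n s := rfl

theorem Sym.symm_prodFn {n : ℕ} (deg : Fin n → ℕ) (z : Fin n → freeLie k A)
    (hz : ∀ i, (z i : Poly k A) ∈ Poly.deg k A (deg i)) :
    symm k A (prodFn k A z) = symmN k A n (prodFn k A z) :=
  finsum_eq_single _ n fun _ hm => symmN_of_ne k A hm deg z hz

theorem Sym.isSymmetrization_symm : IsSymmetrization k A (symm k A) := fun _ deg z hz =>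
  (symm_prodFn k A deg z hz).trans (symmN_prodFn k A deg z hz)

theorem IsSymmetrization.eq_symm {I : Sym k A →ₗ[R] Poly k A} (hI : IsSymmetrization k A I) :
    I = Sym.symm k A := by
  ext s
  induction s using Sym.prod_induction k A with
  | prod n deg z hz => exact (hI n deg z hz).trans (Sym.isSymmetrization_symm k A n deg z hz).symm
  | zero => simp
  | add a b ha hb => simp [ha, hb]
  | smul f a ha => simp [ha]

end SymmetrizationMap

/-! ### Compatibility with the connection and the differential -/

section Compatibility

variable (k : Type u) {R : Type v} {L : Type w} [Field k] [CommRing R] [Algebra k R]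
  [LieRing L] [LieAlgebra k L] [Module R L] [LieRingModule L R] [LieRinehartRing R L]
  [LieRinehartAlgebra k R L] (A : LieRinehartSubalgebra R L)

theorem Poly.iterate_inv_conn (x : L) (i : ℕ) (y : Poly k A) :
    (conn k A).nabla x ((inv k A)^[i] y) = (inv k A)^[i] ((conn k A).nabla x y) := by
  induction i with
  | zero => rfl
  | succ i ih => rw [Function.iterate_succ_apply', Function.iterate_succ_apply', ← ih, inv_conn]

theorem Sym.aug_conn (x : L) (s : Sym k A) :
    aug k A ((conn k A).nabla x s) = (Poly.conn k A).nabla x (aug k A s) := by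
  induction s using hom_induction k A with
  | one => rw [← map_one (algebraMap R (Sym k A)), conn_alg, aug_alg, aug_alg, Poly.conn_alg]
  | add a b ha hb => simp only [map_add, ha, hb]
  | smul f a ha =>
    rw [(conn k A).leibniz, map_add, map_smul, map_smul, map_smul, (Poly.conn k A).leibniz, ha]
  | mul i z a hz ha => rw [conn_mul, conn_inc, map_add, aug_inc_mul, aug_inc_mul, aug_inc_mul,
      add_zero, map_zero]

/-- The differential has odd degree and so anticommutes with each copy of the grade involution. -/
theorem Poly.d_iterate_inv (i : ℕ) (y : Poly k A) :
    d k A ((inv k A)^[i] y) = (-1 : R) ^ i • (inv k A)^[i] (d k A y) := by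
  induction i with
  | zero => simp
  | succ i ih =>
    rw [Function.iterate_succ_apply', Function.iterate_succ_apply',
      ← neg_neg (d k A (inv k A _)), ← inv_d, ih, map_smul, pow_succ, mul_neg_one, neg_smul]

variable [CharZero k]

/-- The covariant derivative preserves degrees, so all terms of the Leibniz rule carry the same
Koszul sign. -/
theorem Sym.rightMul_conn (x : L) {i : ℕ} {z : freeLie k A}
    (hz : (z : Poly k A) ∈ Poly.deg k A i) (w : Poly k A ⊗[R] Sym k A) :
    ((Poly.conn k A).tensor (conn k A)).nabla x (rightMul k A z w) =
      rightMul k A ((freeLie.conn k A).nabla x z) w +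
        rightMul k A z (((Poly.conn k A).tensor (conn k A)).nabla x w) := by
  have hz' := Poly.conn_mem k A x hz
  rw [← freeLie.coe_conn] at hz'
  induction w with
  | zero => simp only [map_zero, add_zero]
  | add a b ha hb => simp only [map_add, ha, hb]; abel
  | tmul y s =>
    rw [rightMul_tmul k A hz, rightMul_tmul k A hz', FlatConnection.tensor_nabla_tmul,
      FlatConnection.tensor_nabla_tmul, map_add, rightMul_tmul k A hz, rightMul_tmul k A hz,
      conn_mul, conn_inc, Poly.iterate_inv_conn, TensorProduct.tmul_add]
    abel

/-- Both sides obey the same recursion in `z ⊙ a`. They are not `R`-linear in `s`, but they have the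
same defect, given by the Leibniz rule for scalars. -/
theorem Sym.split_conn (x : L) (s : Sym k A) : split k A ((conn k A).nabla x s) =
    ((Poly.conn k A).tensor (conn k A)).nabla x (split k A s) := by
  induction s using hom_induction k A with
  | one => rw [split_one, map_zero, ← map_one (algebraMap R (Sym k A)), conn_alg, split_alg]
  | add a b ha hb => simp only [map_add, ha, hb]
  | smul f a ha =>
    rw [(conn k A).leibniz, map_add, map_smul, map_smul, map_smul, FlatConnection.leibniz, ha]
  | mul i z a hz ha =>
    rw [conn_mul, conn_inc, map_add, split_mul, split_mul, split_mul, map_add,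
      FlatConnection.tensor_nabla_tmul, rightMul_conn k A x hz, ha, freeLie.coe_conn]
    abel

theorem Sym.symmN_conn (n : ℕ) (x : L) (s : Sym k A) :
    symmN k A n ((conn k A).nabla x s) = (Poly.conn k A).nabla x (symmN k A n s) := by
  induction n generalizing s with
  | zero => exact aug_conn k A x s
  | succ n ih =>
    -- The product of `D` is equivariant for the diagonal action, and the inductive hypothesis says
    -- the same of `symmN n`.
    have key (w : Poly k A ⊗[R] Sym k A) :
        LinearMap.mul' R (Poly k A) ((symmN k A n).lTensor (Poly k A)
          (((Poly.conn k A).tensor (conn k A)).nabla x w)) = (Poly.conn k A).nabla x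
            (LinearMap.mul' R (Poly k A) ((symmN k A n).lTensor (Poly k A) w)) := by
      induction w with
      | zero => simp only [map_zero]
      | add a b ha hb => simp only [map_add, ha, hb]
      | tmul y s =>
        rw [FlatConnection.tensor_nabla_tmul]
        simp only [map_add, LinearMap.lTensor_tmul, LinearMap.mul'_apply, ih, Poly.conn_mul]
        abel
    -- Covariant derivatives are only `k`-linear, so the scalar `1 / (n + 1)` is taken back from `R`
    -- to `k` before it is pulled out.
    rw [symmN_succ_apply, symmN_succ_apply, split_conn, key, invNat_smul, invNat_smul, map_smul]

theorem Sym.symm_conn (x : L) (s : Sym k A) :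
    symm k A ((conn k A).nabla x s) = (Poly.conn k A).nabla x (symm k A s) := by
  have h := AddMonoidHom.map_finsum ((Poly.conn k A).nabla x).toAddMonoidHom (symmN_finite k A s)
  rw [symm_apply, symm_apply]
  simp only [symmN_conn]
  exact h.symm

/-- The differential `d ⊗ 1 ± 1 ⊗ d` of `D ⊗ S(L(D¹))`. -/
noncomputable def Sym.tensorD : Poly k A ⊗[R] Sym k A →ₗ[R] Poly k A ⊗[R] Sym k A :=
  (Poly.d k A).rTensor (Sym k A) + TensorProduct.map (Poly.inv k A).toLinearMap (d k A)

theorem Sym.tensorD_tmul (y : Poly k A) (s : Sym k A) :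
    tensorD k A (y ⊗ₜ[R] s) = Poly.d k A y ⊗ₜ[R] s + Poly.inv k A y ⊗ₜ[R] d k A s := rfl

/-- A graded Leibniz rule, in which the involution on `z` is the sign of moving `d` past `z`. With
it, `split ∘ d` and `tensorD ∘ split` satisfy the same recursion. -/
theorem Sym.rightMul_d {i : ℕ} {z : freeLie k A}
    (hz : (z : Poly k A) ∈ Poly.deg k A i) (w : Poly k A ⊗[R] Sym k A) :
    tensorD k A (rightMul k A z w) = rightMul k A (freeLie.d k A z) w +
      rightMul k A (freeLie.inv k A z) (tensorD k A w) := by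
  have hz' := Poly.d_mem k A hz
  rw [← freeLie.coe_d] at hz'
  induction w with
  | zero => simp only [map_zero, add_zero]
  | add a b ha hb => simp only [map_add, ha, hb]; abel
  | tmul y s =>
    rw [freeLie.inv_of_mem k A hz, map_smul, LinearMap.smul_apply, tensorD_tmul, map_add,
      rightMul_tmul k A hz, rightMul_tmul k A hz', rightMul_tmul k A hz, rightMul_tmul k A hz,
      tensorD_tmul, d_mul, d_inc, inv_inc, freeLie.inv_of_mem k A hz, Poly.d_iterate_inv,
      -- The involution inside `tensorD`, on either side of the equation, and the degree `i + 1` of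
      -- `d z` lead to the same iterate.
      ← Function.iterate_succ_apply, ← Function.iterate_succ_apply' (Poly.inv k A),
      TensorProduct.tmul_add, map_smul, smul_mul_assoc, TensorProduct.tmul_smul, smul_add,
      ← TensorProduct.smul_tmul']
    abel

theorem Sym.split_d (s : Sym k A) : split k A (d k A s) = tensorD k A (split k A s) := by
  induction s using hom_induction k A with
  | one => rw [split_one, map_zero, ← map_one (algebraMap R (Sym k A)), d_alg, map_zero]
  | add a b ha hb => simp only [map_add, ha, hb]
  | smul f a ha => simp only [map_smul, ha]
  | mul i z a hz ha =>
    rw [d_mul, d_inc, inv_inc, map_add, split_mul, split_mul, split_mul, map_add, tensorD_tmul,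
      rightMul_d k A hz, ha, freeLie.coe_d, freeLie.coe_inv]
    abel

theorem Sym.aug_d (s : Sym k A) : aug k A (d k A s) = Poly.d k A (aug k A s) := by
  induction s using hom_induction k A with
  | one =>
    rw [← map_one (algebraMap R (Sym k A)), d_alg, aug_alg, Poly.d_alg, map_zero]
  | add a b ha hb => simp only [map_add, ha, hb]
  | smul f a ha => simp only [map_smul, ha]
  | mul i z a hz ha =>
    rw [d_mul, d_inc, inv_inc, map_add, aug_inc_mul, aug_inc_mul, aug_inc_mul, add_zero, map_zero]

theorem Sym.symmN_d (n : ℕ) (s : Sym k A) :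
    symmN k A n (d k A s) = Poly.d k A (symmN k A n s) := by
  induction n generalizing s with
  | zero => exact aug_d k A s
  | succ n ih =>
    have key (w : Poly k A ⊗[R] Sym k A) : LinearMap.mul' R (Poly k A)
        ((symmN k A n).lTensor (Poly k A) (tensorD k A w)) = Poly.d k A
          (LinearMap.mul' R (Poly k A) ((symmN k A n).lTensor (Poly k A) w)) := by
      induction w with
      | zero => simp only [map_zero]
      | add a b ha hb => simp only [map_add, ha, hb]
      | tmul y s =>
        rw [tensorD_tmul]
        simp only [map_add, LinearMap.lTensor_tmul, LinearMap.mul'_apply, ih, Poly.d_mul]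
    rw [symmN_succ_apply, symmN_succ_apply, split_d, key, map_smul]

theorem Sym.symm_d (s : Sym k A) : symm k A (d k A s) = Poly.d k A (symm k A s) := by
  have h := AddMonoidHom.map_finsum (Poly.d k A).toAddMonoidHom (symmN_finite k A s)
  rw [symm_apply, symm_apply]
  simp only [symmN_d]
  exact h.symm

end Compatibility

/-! ### Surjectivity: filtration by the length of products -/

section Surjectivity

variable (k : Type u) {R : Type v} {L : Type w} [Field k] [CommRing R] [Algebra k R]
  [LieRing L] [LieAlgebra k L] [Module R L] [LieRingModule L R] [LieRinehartRing R L]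
  [LieRinehartAlgebra k R L] (A : LieRinehartSubalgebra R L)

/-- The span of the tensors of degree `n` that are products of fewer than `m` homogeneous elements
of the free graded Lie algebra. -/
noncomputable def Poly.filt (m n : ℕ) : Submodule R (Poly k A) :=
  Submodule.span R {a | ∃ (l : ℕ) (deg : Fin l → ℕ) (z : Fin l → freeLie k A), l < m ∧
    (∀ i, (z i : Poly k A) ∈ Poly.deg k A (deg i)) ∧ ∑ i, deg i = n ∧ prodFn k A z = a}

theorem Poly.prodFn_mem_filt {m l : ℕ} (h : l < m) (deg : Fin l → ℕ) (z : Fin l → freeLie k A)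
    (hz : ∀ i, (z i : Poly k A) ∈ Poly.deg k A (deg i)) :
    prodFn k A z ∈ filt k A m (∑ i, deg i) :=
  Submodule.subset_span ⟨l, deg, z, h, hz, rfl, rfl⟩

theorem Poly.filt_mono {m m' : ℕ} (h : m ≤ m') (n : ℕ) : filt k A m n ≤ filt k A m' n :=
  Submodule.span_mono fun _ ⟨l, deg, z, hl, hz⟩ => ⟨l, deg, z, hl.trans_le h, hz⟩

theorem Poly.mul_mem_filt {m n i : ℕ} {z : freeLie k A} (hz : (z : Poly k A) ∈ Poly.deg k A i)
    {a : Poly k A} (ha : a ∈ filt k A m n) : (z : Poly k A) * a ∈ filt k A (m + 1) (i + n) := by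
  induction ha using Submodule.span_induction with
  | mem x h =>
    obtain ⟨l, deg, y, hl, hy, rfl, rfl⟩ := h
    refine Submodule.subset_span ⟨l + 1, Fin.cons i deg, Fin.cons z y, by omega,
      Fin.cases hz fun j => hy j, ?_, ?_⟩
    · simp [Fin.sum_univ_succ]
    · rw [prodFn_succ]; rfl
  | zero => simp
  | add x y _ _ hx hy => rw [mul_add]; exact add_mem hx hy
  | smul f x _ hx => rw [mul_smul_comm]; exact Submodule.smul_mem _ _ hx

theorem Poly.zsmul_mem_filt {m n : ℕ} (c : ℤ) {a : Poly k A} (ha : a ∈ filt k A m n) :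
    c • a ∈ filt k A m n := zsmul_mem ha c

/-- Modulo shorter products, each factor of a product of homogeneous elements of the free graded Lie
algebra may be moved to the front. -/
theorem Poly.sum_moveSign_sub_mem_filt {n : ℕ} (deg : Fin (n + 1) → ℕ)
    (z : Fin (n + 1) → freeLie k A) (hz : ∀ i, (z i : Poly k A) ∈ Poly.deg k A (deg i)) :
    ∑ i, moveSign deg i • ((z i : Poly k A) * prodFn k A (fun j => z (i.succAbove j))) -
      ((n + 1 : ℕ) : Poly k A) * prodFn k A z ∈ filt k A (n + 1) (∑ i, deg i) := by
  induction n with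
  | zero => simp [prodFn_succ, moveSign_zero]
  | succ n ih =>
    have hdeg (i : Fin (n + 1)) :
        ∑ j, deg j = deg 0 + deg i.succ + ∑ j : Fin n, deg (i.succAbove j).succ := by
      rw [Fin.sum_univ_succ, Fin.sum_univ_succAbove _ i]
      exact (add_assoc _ _ _).symm
    set z' : Fin (n + 1) → freeLie k A := fun i => z i.succ with hz'
    set deg' : Fin (n + 1) → ℕ := fun i => deg i.succ with hdeg'
    -- `z 0` times the inductive statement for the remaining factors.
    have h1 := mul_mem_filt k A (hz 0) (ih deg' z' (fun i => hz i.succ))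
    rw [show deg 0 + ∑ i, deg' i = ∑ i, deg i from (Fin.sum_univ_succ deg).symm] at h1
    -- The bracket of `z 0` and `z i.succ` lies in `L(D¹)` and counts as a single factor, so the
    -- products in which it replaces these two are one factor shorter.
    let br (i : Fin (n + 1)) : freeLie k A := ⟨_, freeLie.bracket_mem k A (hz 0) (hz i.succ)
      (z 0).2 (z i.succ).2⟩
    have hbr (i : Fin (n + 1)) : (br i : Poly k A) ∈ Poly.deg k A (deg 0 + deg i.succ) :=
      sub_mem (Poly.mul_mem k A (hz 0) (hz i.succ)) (freeLie.sign_mem k A _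
        (by rw [add_comm]; exact Poly.mul_mem k A (hz i.succ) (hz 0)))
    have h2 : ∑ i : Fin (n + 1), moveSign deg' i •
        ((br i : Poly k A) * prodFn k A (fun j => z' (i.succAbove j))) ∈
        filt k A (n + 1 + 1) (∑ i, deg i) := by
      refine sum_mem fun i _ => zsmul_mem_filt k A _ ?_
      rw [hdeg i]
      exact mul_mem_filt k A (hbr i)
        (prodFn_mem_filt k A (Nat.lt_succ_self n) (fun j => deg (i.succAbove j).succ)
        (fun j => z' (i.succAbove j)) (fun j => hz _))
    convert sub_mem h1 h2 using 1
    rw [Fin.sum_univ_succ, moveSign_zero, one_smul, prodFn_succ k A z, mul_sub, Finset.mul_sum]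
    -- The factor `z i.succ` is first moved up to `z 0` and then exchanged with it at the cost of a
    -- bracket.
    have h3 (i : Fin (n + 1)) : moveSign deg i.succ • ((z i.succ : Poly k A) *
        prodFn k A (fun j => z (i.succ.succAbove j))) =
        (z 0 : Poly k A) * moveSign deg' i • ((z' i : Poly k A) *
          prodFn k A (fun j => z' (i.succAbove j))) - moveSign deg' i •
        ((br i : Poly k A) * prodFn k A (fun j => z' (i.succAbove j))) := by
      rw [moveSign_succ, mul_comm, mul_smul, mul_smul_comm, ← smul_sub, prodFn_succ,
        neg_one_pow_zsmul R, ← neg_one_pow_mul_eq_smul]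
      congr 1
      simp only [br, Fin.succ_succAbove_zero, Fin.succ_succAbove_succ, z', sub_mul, mul_assoc,
        sub_sub_cancel]
    simp only [h3, Finset.sum_sub_distrib]
    have h4 : (z 0 : Poly k A) * (((n + 1 : ℕ) : Poly k A) * prodFn k A z') =
        ((n + 1 : ℕ) : Poly k A) * (z 0 * prodFn k A z') := by
      rw [← mul_assoc, ← Nat.cast_comm, mul_assoc]
    have h5 : (fun i => z (Fin.succAbove 0 i)) = z' := by ext i; simp [z']
    rw [h4, h5]
    push_cast
    noncomm_ring

theorem Sym.prodFn_mem_deg {n : ℕ} (deg : Fin n → ℕ) (z : Fin n → freeLie k A)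
    (hz : ∀ i, (z i : Poly k A) ∈ Poly.deg k A (deg i)) :
    prodFn k A z ∈ Sym.deg k A (∑ i, deg i) := by
  induction n with
  | zero => rw [prodFn_zero]; exact one_mem k A
  | succ n ih =>
    rw [prodFn_succ, Fin.sum_univ_succ]
    exact mul_mem k A (inc_mem k A (hz 0)) (ih _ _ fun i => hz _)

theorem Poly.prodFn_mem_deg {n : ℕ} (deg : Fin n → ℕ) (z : Fin n → freeLie k A)
    (hz : ∀ i, (z i : Poly k A) ∈ Poly.deg k A (deg i)) :
    prodFn k A z ∈ Poly.deg k A (∑ i, deg i) := by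
  induction n with
  | zero => rw [prodFn_zero, ← map_one (algebraMap R (Poly k A))]; exact alg_mem k A 1
  | succ n ih =>
    rw [prodFn_succ, Fin.sum_univ_succ]
    exact mul_mem k A (hz 0) (ih _ _ fun i => hz _)

/-- Every tensor is a combination of products of elements of `D¹`, which already lies in `L(D¹)`. -/
theorem Poly.exists_mem_filt {n : ℕ} {a : Poly k A} (ha : a ∈ Poly.deg k A n) :
    ∃ m, a ∈ filt k A m n := by
  refine deg_induction k A (P := fun n a => ∃ m, a ∈ filt k A m n) ?_ ?_ ?_ ha
  · intro f
    refine ⟨1, ?_⟩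
    rw [Algebra.algebraMap_eq_smul_one]
    refine Submodule.smul_mem _ _ ?_
    simpa [prodFn_zero] using
      prodFn_mem_filt k A one_pos Fin.elim0 (Fin.elim0 : Fin 0 → freeLie k A) (fun i => i.elim0)
  · rintro n a b ⟨m, ha⟩ ⟨m', hb⟩
    exact ⟨max m m', add_mem (filt_mono k A (le_max_left _ _) n ha)
      (filt_mono k A (le_max_right _ _) n hb)⟩
  · rintro n p a - ⟨m, ha⟩
    refine ⟨m + 1, ?_⟩
    rw [add_comm n 1]
    exact mul_mem_filt k A (z := ⟨_, freeLie.inc_mem k A p⟩) (inc_mem k A p) ha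

variable [CharZero k]

theorem Sym.symm_prodFn_succ {n : ℕ} (deg : Fin (n + 1) → ℕ) (z : Fin (n + 1) → freeLie k A)
    (hz : ∀ i, (z i : Poly k A) ∈ Poly.deg k A (deg i)) : symm k A (prodFn k A z) =
      invNat k R (n + 1) • ∑ i, moveSign deg i •
        ((z i : Poly k A) * symm k A (prodFn k A (fun j => z (i.succAbove j)))) := by
  rw [symm_prodFn k A deg z hz, symmN_prodFn_succ k A n deg z hz]
  congr 1
  refine Finset.sum_congr rfl fun i _ => ?_
  rw [symm_prodFn k A _ _ (fun j => hz _)]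

theorem Sym.symm_one : symm k A 1 = 1 := by
  have := symm_prodFn k A Fin.elim0 (Fin.elim0 : Fin 0 → freeLie k A) (fun i => i.elim0)
  rw [prodFn_zero] at this
  rw [this, symmN, ← map_one (algebraMap R (Sym k A)), aug_alg, map_one]

/-- The symmetrization map is the identity modulo shorter products. -/
theorem Sym.symm_prodFn_sub_mem_filt {n : ℕ} (deg : Fin n → ℕ) (z : Fin n → freeLie k A)
    (hz : ∀ i, (z i : Poly k A) ∈ Poly.deg k A (deg i)) :
    symm k A (prodFn k A z) - Poly.prodFn k A z ∈ Poly.filt k A n (∑ i, deg i) := by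
  induction n with
  | zero => simp [prodFn_zero, Poly.prodFn_zero, symm_one]
  | succ n ih =>
    have h1 : ∑ i, moveSign deg i • ((z i : Poly k A) *
        (symm k A (prodFn k A (fun j => z (i.succAbove j))) -
          Poly.prodFn k A (fun j => z (i.succAbove j)))) ∈
        Poly.filt k A (n + 1) (∑ i, deg i) := by
      refine sum_mem fun i _ => Poly.zsmul_mem_filt k A _ ?_
      rw [Fin.sum_univ_succAbove _ i]
      exact Poly.mul_mem_filt k A (hz i) (ih _ _ fun j => hz _)
    -- `h1` replaces the inner symmetrizations by plain products, and `sum_moveSign_sub_mem_filt`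
    -- identifies the `n + 1` resulting terms with the original product modulo shorter ones;
    -- division by `n + 1` gives the average.
    have h2 := (Poly.filt k A (n + 1) (∑ i, deg i)).smul_mem (invNat k R (n + 1))
      (add_mem h1 (Poly.sum_moveSign_sub_mem_filt k A deg z hz))
    convert h2 using 1
    rw [symm_prodFn_succ k A deg z hz]
    have h3 : Poly.prodFn k A z =
        invNat k R (n + 1) • (((n + 1 : ℕ) : Poly k A) * Poly.prodFn k A z) := by
      rw [← map_natCast (algebraMap R (Poly k A)), ← Algebra.smul_def, smul_smul, mul_comm,
        natCast_mul_invNat k n.succ_ne_zero, one_smul]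
    conv_lhs => rw [h3]
    rw [← smul_sub]
    congr 1
    simp only [mul_sub, smul_sub, Finset.sum_sub_distrib]
    abel

/-- Symmetrization is unitriangular for the length: a product is its own symmetrization minus a
combination of shorter products, which is in the image by induction. -/
theorem Sym.filt_le_map_symm (m n : ℕ) :
    Poly.filt k A m n ≤ (Sym.deg k A n).map (symm k A) := by
  induction m with
  | zero =>
    refine Submodule.span_le.2 ?_
    rintro _ ⟨l, -, -, hl, -⟩
    omega
  | succ m ih =>
    refine Submodule.span_le.2 ?_
    rintro _ ⟨l, deg, z, hl, hz, rfl, rfl⟩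
    have h := ih (Poly.filt_mono k A (Nat.lt_succ_iff.1 hl) _
      (symm_prodFn_sub_mem_filt k A deg z hz))
    have h' := Submodule.mem_map_of_mem (f := symm k A) (prodFn_mem_deg k A deg z hz)
    simpa using sub_mem h' h

theorem Sym.exists_symm_eq {n : ℕ} {a : Poly k A} (ha : a ∈ Poly.deg k A n) :
    ∃ s ∈ Sym.deg k A n, symm k A s = a := by
  obtain ⟨m, h⟩ := Poly.exists_mem_filt k A ha
  exact filt_le_map_symm k A m n h

theorem Sym.symm_mem {n : ℕ} {s : Sym k A} (hs : s ∈ Sym.deg k A n) :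
    symm k A s ∈ Poly.deg k A n := by
  induction hs using Submodule.span_induction with
  | mem x h =>
    obtain ⟨l, hl, rfl, rfl⟩ := h
    have h1 : (l.map fun p => inc k A p.2).prod = prodFn k A (fun i => (l.get i).2) := by
      change _ = (List.ofFn ((fun p => inc k A p.2) ∘ l.get)).prod
      rw [← List.map_ofFn, List.ofFn_get]
    have hz : ∀ i, ((l.get i).2 : Poly k A) ∈ Poly.deg k A (l.get i).1 :=
      fun i => hl _ (List.get_mem _ _)
    rw [h1]
    have h2 : (l.map Prod.fst).sum = ∑ i, (l.get i).1 := by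
      rw [← List.sum_ofFn]
      change _ = (List.ofFn (Prod.fst ∘ l.get)).sum
      rw [← List.map_ofFn, List.ofFn_get]
    rw [h2]
    have h := isSymmetrization_symm k A _ (fun i => (l.get i).1) (fun i => (l.get i).2) hz
    refine (congrArg (· ∈ Poly.deg k A (∑ i, (l.get i).1)) h).mpr ?_
    rw [← invNat_smul k (R := R)]
    refine Submodule.smul_mem _ _ (sum_mem fun σ _ => zsmul_mem ?_ _)
    have := Poly.prodFn_mem_deg k A (fun i => (l.get (σ i)).1) (fun i => (l.get (σ i)).2)
      (fun i => hz _)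
    -- Permuting the factors does not change the total degree.
    rwa [Equiv.sum_comp σ (fun i => (l.get i).1)] at this
  | zero => simp
  | add x y _ _ hx hy => rw [map_add]; exact add_mem hx hy
  | smul f x _ hx => rw [map_smul]; exact Submodule.smul_mem _ _ hx

end Surjectivity

/-! ### The Dynkin operator and a retraction onto the free graded Lie algebra -/

section Dynkin

variable (k : Type u) {R : Type v} {L : Type w} [Field k] [CommRing R] [Algebra k R]
  [LieRing L] [LieAlgebra k L] [Module R L] [LieRingModule L R] [LieRinehartRing R L]
  [LieRinehartAlgebra k R L] (A : LieRinehartSubalgebra R L)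

noncomputable instance Poly.gradedAlgebra : GradedAlgebra (Poly.deg k A) :=
  TensorAlgebra.gradedAlgebra

/-- Multiplication by `c n` in degree `n`. -/
noncomputable def Poly.scale (c : ℕ → R) : Poly k A →ₗ[R] Poly k A :=
  (DirectSum.toModule R ℕ (Poly k A) (fun n => c n • (deg k A n).subtype)).comp
    (DirectSum.decomposeLinearEquiv (deg k A)).toLinearMap

theorem Poly.scale_of_mem (c : ℕ → R) {n : ℕ} {a : Poly k A} (ha : a ∈ deg k A n) :
    scale k A c a = c n • a := by
  simp only [scale, LinearMap.comp_apply, LinearEquiv.coe_coe,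
    DirectSum.decomposeLinearEquiv_apply, DirectSum.decompose_of_mem _ ha]
  erw [DirectSum.toModule_lof]
  rfl

/-- Induction over the homogeneous elements of the free graded Lie algebra. -/
theorem freeLie.graded_induction {P : ℕ → Poly k A → Prop} (zero : ∀ n, P n 0)
    (add : ∀ n a b, P n a → P n b → P n (a + b)) (smul : ∀ n (f : R) a, P n a → P n (f • a))
    (inc : ∀ p, P 1 (Poly.inc k A p))
    (bracket : ∀ (i j : ℕ) (u v : Poly k A), u ∈ Poly.deg k A i → v ∈ Poly.deg k A j →
      P i u → P j v → P (i + j) (u * v - (-1) ^ (i * j) * (v * u))) {n : ℕ} {z : Poly k A}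
    (hz : z ∈ freeLie k A) (hn : z ∈ Poly.deg k A n) : P n z := by
  -- The elements all of whose homogeneous components satisfy `P`; `scale` with `Pi.single i 1` is
  -- the projection to degree `i`. This recasts a graded statement as a submodule, to which the
  -- minimality of `freeLie` applies.
  let N : Submodule R (Poly k A) :=
    { carrier := {z | ∀ i, P i (Poly.scale k A (Pi.single i 1) z)}
      zero_mem' := fun i => by rw [map_zero]; exact zero i
      add_mem' := fun ha hb i => by rw [map_add]; exact add _ _ _ (ha i) (hb i)
      smul_mem' := fun f a ha i => by rw [map_smul]; exact smul _ _ _ (ha i) }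
  have hom {m : ℕ} {a : Poly k A} (ha : a ∈ Poly.deg k A m) (h : P m a) : a ∈ N := by
    intro i
    rw [Poly.scale_of_mem k A _ ha]
    by_cases hi : m = i
    · subst hi; simpa using h
    · simpa [hi] using zero i
  have hom' {m : ℕ} {a : Poly k A} (ha : a ∈ Poly.deg k A m) (h : a ∈ N) : P m a := by
    have := h m
    rwa [Poly.scale_of_mem k A _ ha, Pi.single_eq_same, one_smul] at this
  refine hom' hn (freeLie.le_of k A N (fun p => hom (Poly.inc_mem k A p) (inc p)) ?_ hz)
  intro i j u v hi hj _ _ hu hv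
  refine hom (sub_mem (Poly.mul_mem k A hi hj) (freeLie.sign_mem k A _ ?_))
    (bracket i j u v hi hj (hom' hi hu) (hom' hj hv))
  rw [add_comm]; exact Poly.mul_mem k A hj hi

/-- The counit of the tensor algebra. -/
noncomputable def Poly.counit : Poly k A →ₐ[R] R := TensorAlgebra.algebraMapInv

theorem freeLie.counit_eq_zero {z : Poly k A} (hz : z ∈ freeLie k A) : Poly.counit k A z = 0 := by
  refine freeLie.le_of k A (LinearMap.ker (Poly.counit k A).toLinearMap) ?_ ?_ hz
  · intro p
    simp [Poly.counit, TensorAlgebra.algebraMapInv]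
  · intro i j u v _ _ _ _ hu hv
    have hu' : Poly.counit k A u = 0 := hu
    simp [hu']

/-- Covers degree 0, where the Dynkin operator cannot be divided by the degree. -/
theorem freeLie.eq_zero_of_mem_deg_zero {z : Poly k A} (hz : z ∈ freeLie k A)
    (h : z ∈ Poly.deg k A 0) : z = 0 := by
  rw [Poly.deg, pow_zero] at h
  obtain ⟨f, rfl⟩ := Submodule.mem_one.1 h
  have := counit_eq_zero k A hz
  rw [AlgHom.commutes] at this
  rw [show f = 0 from this, map_zero]

/-- The operator `(r, x) ↦ (0, r p + [p, x])` with the graded commutator `[p, x]`. -/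
noncomputable def Poly.dynkinGen : DOne k A →ₗ[R] Module.End R (R × Poly k A) where
  toFun p := LinearMap.prod 0 ((LinearMap.toSpanSingleton R _ (inc k A p)).comp
      (LinearMap.fst R _ _) + (LinearMap.mulLeft R (inc k A p) -
        (LinearMap.mulRight R (inc k A p)).comp (inv k A).toLinearMap).comp (LinearMap.snd R _ _))
  map_add' p q := by
    refine LinearMap.ext fun x => Prod.ext (by simp) ?_
    simp [add_mul, mul_add]; abel
  map_smul' f p := by
    refine LinearMap.ext fun x => Prod.ext (by simp) ?_
    simp [smul_sub, smul_comm f]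

/-- The algebra map that defines the Dynkin operator. -/
noncomputable def Poly.dynkinHom : Poly k A →ₐ[R] Module.End R (R × Poly k A) :=
  TensorAlgebra.lift R (dynkinGen k A)

theorem Poly.dynkinHom_inc (p : DOne k A) (q : R × Poly k A) : dynkinHom k A (inc k A p) q =
    (0, q.1 • inc k A p + (inc k A p * q.2 - inv k A q.2 * inc k A p)) := by
  rw [dynkinHom, TensorAlgebra.lift_ι_apply]; rfl

/-- The Dynkin operator `p₁ ⊗ ⋯ ⊗ pₙ ↦ [p₁, [p₂, ⋯ pₙ]]`. -/
noncomputable def Poly.dynkin : Poly k A →ₗ[R] Poly k A :=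
  -- The scalar 1 marks that no letter has been read yet: the last letter `pₙ` turns `(1, 0)` into
  -- `(0, pₙ)`, and every further letter takes a bracket.
  (LinearMap.snd R _ _).comp ((dynkinHom k A).toLinearMap.flip (1, 0))

theorem Poly.dynkin_def (a : Poly k A) : dynkin k A a = (dynkinHom k A a (1, 0)).2 := rfl

theorem Poly.dynkin_one : dynkin k A 1 = 0 := by simp [dynkin_def]

theorem Poly.dynkin_mem (a : Poly k A) : dynkin k A a ∈ freeLie k A := by
  -- Invariance of `R × L(D¹)` is multiplicative in `a`, unlike the statement for the single vector
  -- `(1, 0)`.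
  have key : ∀ q : R × Poly k A, q.2 ∈ freeLie k A → (dynkinHom k A a q).2 ∈ freeLie k A := by
    induction a using TensorAlgebra.induction with
    | algebraMap f =>
      intro q hq
      rw [AlgHom.commutes]
      exact (freeLie k A).smul_mem f hq
    | ι p =>
      rintro ⟨r, x⟩ hx
      rw [dynkinHom_inc k A p]
      refine add_mem ((freeLie k A).smul_mem r (freeLie.inc_mem k A p)) ?_
      -- Written with the involution, the graded commutator is linear in `x`; this allows reduction
      -- to homogeneous `x`, where it is a bracket of `L(D¹)`.
      change inc k A p * (⟨x, hx⟩ : freeLie k A) -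
        inv k A ((⟨x, hx⟩ : freeLie k A) : Poly k A) * inc k A p ∈ freeLie k A
      generalize (⟨x, hx⟩ : freeLie k A) = y
      induction y using freeLie.hom_induction k A with
      | hom j y hy =>
        have := freeLie.bracket_mem k A (inc_mem k A p) hy (freeLie.inc_mem k A p) y.2
        rwa [one_mul, ← mul_assoc, ← inv_of_mem k A hy] at this
      | zero => simp
      | add x y hx hy =>
        convert add_mem hx hy using 1
        push_cast
        rw [map_add]
        noncomm_ring
    | mul a b ha hb => intro q hq; rw [map_mul]; exact ha _ (hb q hq)
    | add a b ha hb => intro q hq; rw [map_add]; exact add_mem (ha q hq) (hb q hq)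
  exact key (1, 0) (zero_mem _)

theorem Poly.iterate_inv_smul (i : ℕ) (f : R) (x : Poly k A) :
    (inv k A)^[i] (f • x) = f • (inv k A)^[i] x := by
  rw [iterate_inv, iterate_inv, map_smul, smul_ite]

theorem Poly.inv_iterate_mul_of_mem {i j : ℕ} {v : Poly k A} (hv : v ∈ deg k A j) (x : Poly k A) :
    (inv k A)^[i] (v * x) = (-1) ^ (i * j) * (v * (inv k A)^[i] x) ∧
    (inv k A)^[i] (x * v) = (-1) ^ (i * j) * ((inv k A)^[i] x * v) := by
  rw [iterate_map_mul, iterate_map_mul, iterate_inv_of_mem k A hv, ← neg_one_pow_mul_eq_smul]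
  rcases neg_one_pow_eq_or (Poly k A) (i * j) with h | h <;> simp [h]

/-- The theorem of Dynkin, Specht and Wever: in degree `n`, the Dynkin operator is multiplication by
`n` on the free graded Lie algebra. -/
theorem Poly.dynkinHom_of_mem {n : ℕ} {z : Poly k A} (hz : z ∈ freeLie k A)
    (hn : z ∈ deg k A n) : ∀ q : R × Poly k A, dynkinHom k A z q =
      (0, q.1 • (n : R) • z + (z * q.2 - (inv k A)^[n] q.2 * z)) := by
  -- The induction needs the action on every pair `(r, x)`, namely `(0, r n z + [z, x])`. For a
  -- bracket `[u, v]`, the Jacobi identity handles the part in `x`, and the part in `r` is `[u, j v]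
  -- + [i u, v] = (i + j) [u, v]`.
  refine freeLie.graded_induction k A (P := fun n z => ∀ q : R × Poly k A, dynkinHom k A z q =
      (0, q.1 • (n : R) • z + (z * q.2 - (inv k A)^[n] q.2 * z))) ?_ ?_ ?_ ?_ ?_ hz hn
  · intro n q; simp; rfl
  · intro n a b ha hb q
    rw [map_add, LinearMap.add_apply, ha, hb, Prod.mk_add_mk, smul_add, smul_add, add_zero]
    congr 1
    noncomm_ring
  · intro n f a ha q
    rw [map_smul, LinearMap.smul_apply, ha, Prod.smul_mk, smul_zero, smul_add, smul_sub,
      smul_comm f, smul_comm f (n : R), smul_mul_assoc, mul_smul_comm]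
  · intro p q
    rw [dynkinHom_inc]; simp
  · intro i j u v hi hj hu hv q
    have h1 := inv_iterate_mul_of_mem k A (i := i) hj
    have h2 := inv_iterate_mul_of_mem k A (i := j) hi
    have h3 : (inv k A)^[i] v = (-1) ^ (i * j) * v := by
      have := (h1 1).1
      rwa [mul_one, iterate_map_one, mul_one] at this
    have h4 : (inv k A)^[j] u = (-1) ^ (i * j) * u := by
      have := (h2 1).1
      rwa [mul_one, iterate_map_one, mul_one, mul_comm j i] at this
    have h5 : (inv k A)^[j] ((inv k A)^[i] q.2) = (inv k A)^[i + j] q.2 := by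
      rw [add_comm, Function.iterate_add_apply]
    have h6 : (inv k A)^[i] ((inv k A)^[j] q.2) = (inv k A)^[i + j] q.2 := by
      rw [Function.iterate_add_apply]
    rw [map_sub, map_mul, neg_one_pow_mul_eq_smul R (i * j) (v * u), map_smul, map_mul,
      LinearMap.sub_apply, LinearMap.smul_apply, Module.End.mul_apply, Module.End.mul_apply,
      hu, hv, hu, hv]
    refine Prod.ext (by simp) ?_
    simp only [Prod.snd_sub, Prod.smul_snd, zero_smul, zero_add, iterate_map_add,
      iterate_map_sub, iterate_inv_smul, (h1 _).1, (h1 _).2, (h2 _).1, (h2 _).2, h3, h4, h5, h6,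
      Nat.cast_add, add_smul]
    rw [mul_comm j i]
    rcases Nat.even_or_odd (i * j) with h | h <;>
    simp only [h.neg_one_pow, one_mul, one_smul, neg_one_smul, mul_add, add_mul,
      mul_sub, sub_mul, smul_mul_assoc, mul_smul_comm, smul_add, smul_sub, smul_neg,
      neg_mul, mul_assoc, neg_neg, sub_neg_eq_add] <;>
    abel

theorem Poly.dynkin_of_mem {n : ℕ} {z : Poly k A} (hz : z ∈ freeLie k A)
    (hn : z ∈ deg k A n) : dynkin k A z = (n : R) • z := by
  rw [dynkin_def, dynkinHom_of_mem k A hz hn]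
  simp [iterate_map_zero]

/-- The projection of the tensor algebra onto the free graded Lie algebra, which is the Dynkin
operator divided by `n` in degree `n`. -/
noncomputable def Poly.lieProj : Poly k A →ₗ[R] freeLie k A :=
  -- In degree 0 the scalar is the inverse of 0, which is 0 by convention; the Dynkin operator
  -- vanishes there anyway.
  ((dynkin k A).comp (scale k A (fun n => invNat k R n))).codRestrict (freeLie k A)
    (fun _ => dynkin_mem k A _)

theorem Poly.lieProj_one : lieProj k A 1 = 0 := by
  refine Subtype.ext ?_
  have h1 : (1 : Poly k A) ∈ deg k A 0 := by
    rw [← map_one (algebraMap R (Poly k A))]; exact alg_mem k A 1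
  change dynkin k A (scale k A _ 1) = 0
  rw [scale_of_mem k A _ h1, map_smul, dynkin_one, smul_zero]

/-- Makes `L(D¹)` a direct summand of `D` over any `R`; the injectivity proof uses this retraction
in place of a basis. -/
theorem Poly.lieProj_coe [CharZero k] (z : freeLie k A) : lieProj k A z = z := by
  induction z using freeLie.hom_induction k A with
  | hom n z hz =>
    refine Subtype.ext ?_
    change dynkin k A (scale k A _ z) = z
    rw [scale_of_mem k A _ hz, map_smul, dynkin_of_mem k A z.2 hz, smul_smul]
    rcases Nat.eq_zero_or_pos n with rfl | h
    · rw [freeLie.eq_zero_of_mem_deg_zero k A z.2 hz, smul_zero]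
    · rw [mul_comm, natCast_mul_invNat k h.ne', one_smul]
  | zero => simp
  | add x y hx hy =>
    have := map_add (lieProj k A) (x : Poly k A) y
    rw [hx, hy] at this
    exact this

end Dynkin

/-! ### Injectivity: the coproduct and convolution powers of the retraction -/

section Injectivity

variable (k : Type u) {R : Type v} {L : Type w} [Field k] [CommRing R] [Algebra k R]
  [LieRing L] [LieAlgebra k L] [Module R L] [LieRingModule L R] [LieRinehartRing R L]
  [LieRinehartAlgebra k R L] (A : LieRinehartSubalgebra R L)

/-- The operator `a ⊗ b ↦ (p ⊗ a) ⊗ b + inv a ⊗ (p ⊗ b)`. -/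
noncomputable def Poly.coprodGen : DOne k A →ₗ[R] Module.End R (Poly k A ⊗[R] Poly k A) :=
  ((TensorProduct.mapBilinear (RingHom.id R) _ _ _ _).flip LinearMap.id).comp
      ((LinearMap.mul R (Poly k A)).comp (inc k A)) +
    (TensorProduct.mapBilinear (RingHom.id R) _ _ _ _ (inv k A).toLinearMap).comp
      ((LinearMap.mul R (Poly k A)).comp (inc k A))

/-- The algebra map that defines the comultiplication of the tensor algebra. -/
noncomputable def Poly.coprodHom : Poly k A →ₐ[R] Module.End R (Poly k A ⊗[R] Poly k A) :=
  TensorAlgebra.lift R (coprodGen k A)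

theorem Poly.coprodHom_inc (p : DOne k A) (a b : Poly k A) :
    coprodHom k A (inc k A p) (a ⊗ₜ[R] b) =
      (inc k A p * a) ⊗ₜ[R] b + inv k A a ⊗ₜ[R] (inc k A p * b) := by
  rw [coprodHom, TensorAlgebra.lift_ι_apply]; rfl

/-- The graded cocommutative comultiplication of the tensor algebra, for which the elements of degree
one are primitive. -/
noncomputable def Poly.coprod : Poly k A →ₗ[R] Poly k A ⊗[R] Poly k A :=
  (coprodHom k A).toLinearMap.flip (1 ⊗ₜ[R] 1)

theorem Poly.coprod_def (a : Poly k A) : coprod k A a = coprodHom k A a (1 ⊗ₜ[R] 1) := rfl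

theorem Poly.coprod_mul (a b : Poly k A) :
    coprod k A (a * b) = coprodHom k A a (coprod k A b) := by
  rw [coprod_def, map_mul]; rfl

/-- Lie elements are primitive: `z` acts as `z ⊗ 1 + 1 ⊗ z` with the Koszul sign. This form is
stable under graded commutators, because the mixed terms with one element on each side cancel. -/
theorem Poly.coprodHom_of_mem {n : ℕ} {z : Poly k A} (hz : z ∈ freeLie k A)
    (hn : z ∈ deg k A n) : ∀ a b : Poly k A, coprodHom k A z (a ⊗ₜ[R] b) =
      (z * a) ⊗ₜ[R] b + (inv k A)^[n] a ⊗ₜ[R] (z * b) := by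
  refine freeLie.graded_induction k A (P := fun n z => ∀ a b : Poly k A,
    coprodHom k A z (a ⊗ₜ[R] b) =
      (z * a) ⊗ₜ[R] b + (inv k A)^[n] a ⊗ₜ[R] (z * b)) ?_ ?_ ?_ ?_ ?_ hz hn
  · intro n a b; simp
  · intro n x y hx hy a b
    rw [map_add, LinearMap.add_apply, hx, hy, add_mul, add_mul, TensorProduct.add_tmul,
      TensorProduct.tmul_add]
    abel
  · intro n f x hx a b
    rw [map_smul, LinearMap.smul_apply, hx, smul_add, smul_mul_assoc, smul_mul_assoc,
      TensorProduct.tmul_smul, TensorProduct.smul_tmul']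
  · intro p a b
    exact coprodHom_inc k A p a b
  · intro i j x y hi hj hx hy a b
    have h1 (c : Poly k A) : (inv k A)^[i] (y * c) = (-1 : R) ^ (i * j) • (y * (inv k A)^[i] c) := by
      rw [(inv_iterate_mul_of_mem k A hj c).1, neg_one_pow_mul_eq_smul R]
    have h2 (c : Poly k A) : (inv k A)^[j] (x * c) = (-1 : R) ^ (i * j) • (x * (inv k A)^[j] c) := by
      rw [(inv_iterate_mul_of_mem k A hi c).1, neg_one_pow_mul_eq_smul R, mul_comm j]
    have h5 : (inv k A)^[j] ((inv k A)^[i] a) = (inv k A)^[i + j] a := by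
      rw [add_comm, Function.iterate_add_apply]
    have h6 : (inv k A)^[i] ((inv k A)^[j] a) = (inv k A)^[i + j] a := by
      rw [Function.iterate_add_apply]
    have hs : (-1 : R) ^ (i * j) * (-1 : R) ^ (i * j) = 1 := by
      rw [← pow_add, Even.neg_one_pow ⟨i * j, rfl⟩]
    rw [map_sub, map_mul, neg_one_pow_mul_eq_smul R (i * j) (y * x), map_smul, map_mul,
      LinearMap.sub_apply, LinearMap.smul_apply, Module.End.mul_apply, Module.End.mul_apply,
      hx, hy, map_add, map_add, hx, hx, hy, hy, h1, h2, h5, h6]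
    simp only [sub_mul, smul_mul_assoc, TensorProduct.sub_tmul, TensorProduct.tmul_sub,
      ← TensorProduct.smul_tmul', TensorProduct.tmul_smul, smul_add, smul_smul, hs, one_smul,
      mul_assoc]
    abel

/-- The span of the tensors `a ⊗ b` where `b` is a product of fewer than `m` homogeneous elements of
the free graded Lie algebra. -/
noncomputable def Poly.rightFilt (m : ℕ) : Submodule R (Poly k A ⊗[R] Poly k A) :=
  Submodule.span R {t | ∃ (l : ℕ) (deg : Fin l → ℕ) (z : Fin l → freeLie k A) (a : Poly k A),
    l < m ∧ (∀ i, (z i : Poly k A) ∈ Poly.deg k A (deg i)) ∧ a ⊗ₜ[R] prodFn k A z = t}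

theorem Poly.tmul_prodFn_mem_rightFilt {m l : ℕ} (h : l < m) (deg : Fin l → ℕ)
    (z : Fin l → freeLie k A) (hz : ∀ i, (z i : Poly k A) ∈ Poly.deg k A (deg i))
    (a : Poly k A) : a ⊗ₜ[R] prodFn k A z ∈ rightFilt k A m :=
  Submodule.subset_span ⟨l, deg, z, a, h, hz, rfl⟩

theorem Poly.rightFilt_mono {m m' : ℕ} (h : m ≤ m') : rightFilt k A m ≤ rightFilt k A m' :=
  Submodule.span_mono fun _ ⟨l, deg, z, a, hl, hz⟩ => ⟨l, deg, z, a, hl.trans_le h, hz⟩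

/-- A primitive element multiplies either the left or the right side, so the right side gains at
most one factor. -/
theorem Poly.coprodHom_mem_rightFilt {m i : ℕ} {z : freeLie k A}
    (hz : (z : Poly k A) ∈ Poly.deg k A i) {t : Poly k A ⊗[R] Poly k A}
    (ht : t ∈ rightFilt k A m) : coprodHom k A z t ∈ rightFilt k A (m + 1) := by
  induction ht using Submodule.span_induction with
  | mem x h =>
    obtain ⟨l, deg, y, a, hl, hy, rfl⟩ := h
    rw [coprodHom_of_mem k A z.2 hz]
    refine add_mem (tmul_prodFn_mem_rightFilt k A (by omega) deg y hy _) ?_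
    exact Submodule.subset_span ⟨l + 1, Fin.cons i deg, Fin.cons z y, _, by omega,
      Fin.cases hz fun j => hy j, by rw [prodFn_succ]; rfl⟩
  | zero => simp
  | add x y _ _ hx hy => rw [map_add]; exact add_mem hx hy
  | smul f x _ hx => rw [map_smul]; exact Submodule.smul_mem _ _ hx

theorem Poly.coprod_one : coprod k A 1 = 1 ⊗ₜ[R] 1 := by
  rw [coprod_def, map_one]; rfl

/-- The coproduct distributes the factors over the two sides; only one term puts all of them on the
right. -/
theorem Poly.coprod_sub_mem_rightFilt {n : ℕ} (deg : Fin n → ℕ) (z : Fin n → freeLie k A)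
    (hz : ∀ i, (z i : Poly k A) ∈ Poly.deg k A (deg i)) :
    coprod k A (prodFn k A z) - 1 ⊗ₜ[R] prodFn k A z ∈ rightFilt k A n := by
  induction n with
  | zero => simp [prodFn_zero, coprod_one]
  | succ n ih =>
    have h1 := coprodHom_mem_rightFilt k A (hz 0) (ih _ _ fun i => hz i.succ)
    have h2 := tmul_prodFn_mem_rightFilt k A n.lt_succ_self _ _ (fun i => hz i.succ) (z 0)
    rw [prodFn_succ, coprod_mul]
    convert add_mem h1 h2 using 1
    rw [map_sub, coprodHom_of_mem k A (z 0).2 (hz 0), iterate_map_one, mul_one]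
    abel

/-- The next layer consists of the terms with exactly one factor on the left; it has the same shape
as `Sym.split_prodFn`. -/
theorem Poly.coprod_sub_sum_mem_rightFilt {n : ℕ} (deg : Fin (n + 1) → ℕ)
    (z : Fin (n + 1) → freeLie k A) (hz : ∀ i, (z i : Poly k A) ∈ Poly.deg k A (deg i)) :
    coprod k A (prodFn k A z) - 1 ⊗ₜ[R] prodFn k A z - ∑ i, moveSign deg i •
      ((z i : Poly k A) ⊗ₜ[R] prodFn k A (fun j => z (i.succAbove j))) ∈ rightFilt k A n := by
  induction n with
  | zero =>
    rw [prodFn_succ, coprod_mul, prodFn_zero, coprod_one, coprodHom_of_mem k A (z 0).2 (hz 0),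
      iterate_map_one, Fin.sum_univ_one, moveSign_zero, one_smul, prodFn_zero, mul_one]
    simp
  | succ n ih =>
    have h1 := coprodHom_mem_rightFilt k A (hz 0)
      (ih (fun i => deg i.succ) (fun i => z i.succ) fun i => hz i.succ)
    -- The terms with both `z 0` and one later factor on the left: only `n` of the `n + 2` factors
    -- remain on the right.
    have h2 : ∑ i : Fin (n + 1), moveSign (fun i => deg i.succ) i •
        ((z 0 * z i.succ : Poly k A) ⊗ₜ[R] prodFn k A (fun j => z (i.succAbove j).succ)) ∈
        rightFilt k A (n + 1) := sum_mem fun i _ => zsmul_mem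
      (tmul_prodFn_mem_rightFilt k A n.lt_succ_self _ _ (fun j => hz _) _) _
    rw [prodFn_succ, coprod_mul]
    convert add_mem h1 h2 using 1
    -- Of the two terms of `coprodHom (z 0)`, the one with `z 0` on the right is wanted; the other
    -- is subtracted and belongs to `h2`.
    have h3 (i : Fin (n + 1)) : moveSign deg i.succ •
        ((z i.succ : Poly k A) ⊗ₜ[R] prodFn k A (fun j => z (i.succ.succAbove j))) =
        moveSign (fun i => deg i.succ) i • (coprodHom k A (z 0)
          ((z i.succ : Poly k A) ⊗ₜ[R] prodFn k A (fun j => z (i.succAbove j).succ))) -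
        moveSign (fun i => deg i.succ) i •
          ((z 0 * z i.succ : Poly k A) ⊗ₜ[R] prodFn k A (fun j => z (i.succAbove j).succ)) := by
      refine Eq.trans ?_ (zsmul_sub _ _ (moveSign (fun i => deg i.succ) i))
      rw [coprodHom_of_mem k A (z 0).2 (hz 0), add_sub_cancel_left,
        iterate_inv_of_mem k A (hz i.succ), ← neg_one_pow_zsmul R, ← TensorProduct.smul_tmul',
        smul_smul, moveSign_succ, mul_comm, prodFn_succ]
      simp only [Fin.succ_succAbove_zero, Fin.succ_succAbove_succ]
    rw [Fin.sum_univ_succ (n := n + 1)]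
    simp only [h3]
    rw [map_sub, map_sub, map_sum, Finset.sum_sub_distrib, coprodHom_of_mem k A (z 0).2 (hz 0),
      iterate_map_one, mul_one, moveSign_zero, one_smul]
    simp only [map_zsmul, Fin.succAbove_zero]
    abel

/-- The map from the tensor algebra to the graded symmetric algebra that is the `n`-fold convolution
power of the projection onto the free graded Lie algebra. -/
noncomputable def Poly.symbol : ℕ → (Poly k A →ₗ[R] Sym k A)
  | 0 => (Algebra.linearMap R (Sym k A)).comp (counit k A).toLinearMap
  | n + 1 => ((LinearMap.mul' R (Sym k A)).comp (TensorProduct.map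
      ((Sym.inc k A).comp (lieProj k A)) (symbol n))).comp (coprod k A)

/-- The vanishing on short products is a hypothesis here because it is the inductive hypothesis of
`Poly.symbol_prodFn_of_lt`. -/
theorem Poly.mul_map_symbol_eq_zero {n : ℕ} (h : ∀ (l : ℕ) (deg : Fin l → ℕ)
    (z : Fin l → freeLie k A), l < n → (∀ i, (z i : Poly k A) ∈ Poly.deg k A (deg i)) →
      symbol k A n (prodFn k A z) = 0) {t : Poly k A ⊗[R] Poly k A} (ht : t ∈ rightFilt k A n) :
    LinearMap.mul' R (Sym k A) (TensorProduct.map ((Sym.inc k A).comp (lieProj k A))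
      (symbol k A n) t) = 0 := by
  induction ht using Submodule.span_induction with
  | mem x hx =>
    obtain ⟨l, deg, z, a, hl, hz, rfl⟩ := hx
    rw [TensorProduct.map_tmul, h l deg z hl hz, LinearMap.mul'_apply, mul_zero]
  | zero => simp
  | add x y _ _ hx hy => rw [map_add, map_add, hx, hy, add_zero]
  | smul f x _ hx => rw [map_smul, map_smul, hx, smul_zero]

theorem Poly.mul_map_symbol_one_tmul (n : ℕ) (a : Poly k A) :
    LinearMap.mul' R (Sym k A) (TensorProduct.map ((Sym.inc k A).comp (lieProj k A))
      (symbol k A n) (1 ⊗ₜ[R] a)) = 0 := by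
  rw [TensorProduct.map_tmul, LinearMap.comp_apply, lieProj_one, map_zero, LinearMap.mul'_apply,
    zero_mul]

/-- In the coproduct, the term `1 ⊗ z₁ ⋯ zₗ` dies because `lieProj` kills 1; the other terms have
fewer than `l` factors on the right and die by induction. -/
theorem Poly.symbol_prodFn_of_lt {n l : ℕ} (h : l < n) (deg : Fin l → ℕ)
    (z : Fin l → freeLie k A) (hz : ∀ i, (z i : Poly k A) ∈ Poly.deg k A (deg i)) :
    symbol k A n (prodFn k A z) = 0 := by
  induction n generalizing l with
  | zero => omega
  | succ n ih =>
    have h1 := mul_map_symbol_eq_zero k A (n := n) (fun l deg z hl hz => ih hl deg z hz)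
      (rightFilt_mono k A (Nat.lt_succ_iff.1 h) (coprod_sub_mem_rightFilt k A deg z hz))
    rw [map_sub, map_sub, mul_map_symbol_one_tmul, sub_zero] at h1
    exact h1

theorem Poly.symbol_of_mem_filt {n m : ℕ} {a : Poly k A} (ha : a ∈ filt k A n m) :
    symbol k A n a = 0 := by
  induction ha using Submodule.span_induction with
  | mem x hx =>
    obtain ⟨l, deg, z, hl, hz, -, rfl⟩ := hx
    exact symbol_prodFn_of_lt k A hl deg z hz
  | zero => simp
  | add x y _ _ hx hy => rw [map_add, hx, hy, add_zero]
  | smul f x _ hx => rw [map_smul, hx, smul_zero]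

/-- Moving the `i`-th factor of a product of homogeneous elements to the front. -/
theorem Sym.moveSign_smul_mul_prodFn {n : ℕ} (deg : Fin (n + 1) → ℕ)
    (z : Fin (n + 1) → freeLie k A) (hz : ∀ i, (z i : Poly k A) ∈ Poly.deg k A (deg i))
    (i : Fin (n + 1)) : moveSign deg i • (inc k A (z i) *
      prodFn k A (fun j => z (i.succAbove j))) = prodFn k A z := by
  induction n with
  | zero =>
    obtain rfl : i = 0 := Fin.fin_one_eq_zero i
    rw [moveSign_zero, one_smul, prodFn_succ k A z]
    simp
  | succ n ih =>
    cases i using Fin.cases with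
    | zero => rw [moveSign_zero, one_smul, prodFn_succ k A z]; simp
    | succ i =>
      rw [moveSign_succ, mul_comm, mul_smul, neg_one_pow_zsmul R, ← neg_one_pow_mul_eq_smul,
        prodFn_succ, prodFn_succ k A z, ← ih _ _ (fun i => hz i.succ) i, mul_smul_comm]
      congr 1
      simp only [Fin.succ_succAbove_zero, Fin.succ_succAbove_succ]
      rw [← mul_assoc (inc k A (z i.succ)), ← mul_assoc ((-1) ^ _), ← inc_comm k A (hz 0)
        (hz i.succ), mul_assoc]

/-- The span of the products of fewer than `m` homogeneous elements of the free graded Lie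
algebra. -/
noncomputable def Sym.filt (m : ℕ) : Submodule R (Sym k A) :=
  Submodule.span R {s | ∃ (l : ℕ) (deg : Fin l → ℕ) (z : Fin l → freeLie k A), l < m ∧
    (∀ i, (z i : Poly k A) ∈ Poly.deg k A (deg i)) ∧ prodFn k A z = s}

theorem Sym.filt_mono {m m' : ℕ} (h : m ≤ m') : filt k A m ≤ filt k A m' :=
  Submodule.span_mono fun _ ⟨l, deg, z, hl, hz⟩ => ⟨l, deg, z, hl.trans_le h, hz⟩

theorem Sym.exists_mem_filt (s : Sym k A) : ∃ m, s ∈ filt k A m := by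
  induction s using prod_induction k A with
  | prod n deg z hz => exact ⟨n + 1, Submodule.subset_span ⟨n, deg, z, n.lt_succ_self, hz, rfl⟩⟩
  | zero => exact ⟨0, zero_mem _⟩
  | add a b ha hb =>
    obtain ⟨m, ha⟩ := ha
    obtain ⟨m', hb⟩ := hb
    exact ⟨max m m', add_mem (filt_mono k A (le_max_left _ _) ha)
      (filt_mono k A (le_max_right _ _) hb)⟩
  | smul f a ha =>
    obtain ⟨m, ha⟩ := ha
    exact ⟨m, Submodule.smul_mem _ f ha⟩

variable [CharZero k]

/-- Only the terms of the coproduct with one factor on the left survive. `lieProj` fixes that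
factor, and in the graded symmetric algebra each of the `n + 1` terms equals `n!` times the full
product, since the sign undoes the move. -/
theorem Poly.symbol_prodFn {n : ℕ} (deg : Fin n → ℕ) (z : Fin n → freeLie k A)
    (hz : ∀ i, (z i : Poly k A) ∈ Poly.deg k A (deg i)) :
    symbol k A n (prodFn k A z) = (n.factorial : R) • Sym.prodFn k A z := by
  induction n with
  | zero => simp [prodFn_zero, Sym.prodFn_zero, symbol]
  | succ n ih =>
    have h1 := mul_map_symbol_eq_zero k A (n := n)
      (fun l deg z hl hz => symbol_prodFn_of_lt k A hl deg z hz)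
      (coprod_sub_sum_mem_rightFilt k A deg z hz)
    rw [map_sub, map_sub, map_sub, map_sub, mul_map_symbol_one_tmul, sub_zero, sub_eq_zero] at h1
    refine h1.trans ?_
    have h2 (i : Fin (n + 1)) : moveSign deg i • (Sym.inc k A (z i) *
        (n.factorial : R) • Sym.prodFn k A (fun j => z (i.succAbove j))) =
        (n.factorial : R) • Sym.prodFn k A z := by
      rw [mul_smul_comm, smul_comm, Sym.moveSign_smul_mul_prodFn k A deg z hz]
    simp only [map_sum, map_zsmul, TensorProduct.map_tmul, LinearMap.mul'_apply,
      LinearMap.comp_apply, lieProj_coe, ih _ _ (fun j => hz _), h2]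
    rw [Finset.sum_const, Finset.card_univ, Fintype.card_fin, Nat.factorial_succ, Nat.cast_mul,
      mul_smul, Nat.cast_smul_eq_nsmul R (n + 1)]

/-- Symmetrization changes products of at most `n` factors only by shorter ones, which `symbol n`
kills; so `symbol n` recovers the part of length `n`, multiplied by `n!`. -/
theorem Sym.symbol_symm_sub_mem_filt {n : ℕ} {s : Sym k A} (hs : s ∈ filt k A (n + 1)) :
    Poly.symbol k A n (symm k A s) - (n.factorial : R) • s ∈ filt k A n := by
  induction hs using Submodule.span_induction with
  | mem x hx =>
    obtain ⟨l, deg, z, hl, hz, rfl⟩ := hx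
    have h1 := Poly.symbol_of_mem_filt k A (Poly.filt_mono k A (Nat.lt_succ_iff.1 hl) _
      (symm_prodFn_sub_mem_filt k A deg z hz))
    rw [map_sub, sub_eq_zero] at h1
    rw [h1]
    rcases (Nat.lt_succ_iff.1 hl).lt_or_eq with h | rfl
    · rw [Poly.symbol_prodFn_of_lt k A h deg z hz, zero_sub]
      exact neg_mem (Submodule.smul_mem _ _ (Submodule.subset_span ⟨l, deg, z, h, hz, rfl⟩))
    · rw [Poly.symbol_prodFn k A deg z hz, sub_self]
      exact zero_mem _
  | zero => simp
  | add x y _ _ hx hy =>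
    rw [map_add, map_add, smul_add, add_sub_add_comm]; exact add_mem hx hy
  | smul f x _ hx =>
    rw [map_smul, map_smul, smul_comm, ← smul_sub]; exact Submodule.smul_mem _ _ hx

theorem Sym.symm_injective : Function.Injective (symm k A) := by
  rw [injective_iff_map_eq_zero]
  intro s hs
  obtain ⟨m, hm⟩ := exists_mem_filt k A s
  induction m with
  | zero =>
    have h : filt k A 0 = ⊥ := Submodule.span_eq_bot.2 (by rintro _ ⟨l, -, -, hl, -⟩; omega)
    rwa [h, Submodule.mem_bot] at hm
  | succ n ih =>
    refine ih ?_
    -- If `s` has symmetrization 0, this says that `n! s` lies one step lower in the filtration; the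
    -- descent ends at `filt 0`, which is zero.
    have h := symbol_symm_sub_mem_filt k A hm
    rw [hs, map_zero, zero_sub, neg_mem_iff] at h
    have h' := (filt k A n).smul_mem (invNat k R n.factorial) h
    rwa [smul_smul, mul_comm, natCast_mul_invNat k n.factorial_ne_zero, one_smul] at h'

end Injectivity

/-! ### The isomorphism of complexes of modules over `U(A)` -/

section ComplexIso

open CategoryTheory

/-- A bijective `R`-linear map that commutes with the connections is an isomorphism of
`U(L)`-modules. -/
theorem FlatConnection.isIso_homOf {k : Type*} {R : Type*} {L : Type*} [Field k] [CommRing R]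
    [Algebra k R] [LieRing L] [LieAlgebra k L] [Module R L] [LieRingModule L R]
    [LieRinehartRing R L] [LieRinehartAlgebra k R L]
    {E F : Type v} [AddCommGroup E] [Module k E] [Module R E] [IsScalarTower k R E]
    [AddCommGroup F] [Module k F] [Module R F] [IsScalarTower k R F]
    (C : FlatConnection k R L E) (C' : FlatConnection k R L F) (φ : E →ₗ[R] F)
    (h : ∀ x e, φ (C.nabla x e) = C'.nabla x (φ e)) (hφ : Function.Bijective φ) :
    IsIso (homOf C C' φ h) :=
  (ConcreteCategory.isIso_iff_bijective _).2 hφ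

variable (k : Type u) {R : Type v} {L : Type w} [Field k] [CharZero k] [CommRing R] [Algebra k R]
  [LieRing L] [LieAlgebra k L] [Module R L] [LieRingModule L R] [LieRinehartRing R L]
  [LieRinehartAlgebra k R L] (A : LieRinehartSubalgebra R L)

/-- The symmetrization map in degree `n`. -/
noncomputable def Sym.symmDeg (n : ℕ) : Sym.deg k A n →ₗ[R] Poly.deg k A n :=
  (symm k A).restrict (fun _ h => symm_mem k A h)

theorem Sym.symmDeg_bijective (n : ℕ) : Function.Bijective (symmDeg k A n) := by
  constructor
  · intro s t h
    exact Subtype.ext (symm_injective k A (congrArg Subtype.val h))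
  · rintro ⟨a, ha⟩
    obtain ⟨s, hs, rfl⟩ := exists_symm_eq k A ha
    exact ⟨⟨s, hs⟩, rfl⟩

/-- The symmetrization map as a morphism of modules over `U(A)`, in degree `n`. -/
noncomputable def Sym.symmHom (n : ℕ) : (symComplex k A).X n ⟶ (polyComplex k A).X n :=
  FlatConnection.homOf
    (((Sym.conn k A).restrictTo A).restrict (Sym.deg k A n) (fun x _ h => Sym.conn_mem k A x h))
    (((Poly.conn k A).restrictTo A).restrict (Poly.deg k A n)
      (fun x _ h => Poly.conn_mem k A x h))
    (symmDeg k A n) (fun x s => Subtype.ext (symm_conn k A x s))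

instance Sym.isIso_symmHom (n : ℕ) : IsIso (symmHom k A n) :=
  FlatConnection.isIso_homOf _ _ _ _ (symmDeg_bijective k A n)

/-- The symmetrization map as an isomorphism of complexes. -/
noncomputable def Sym.symmIso : symComplex k A ≅ polyComplex k A :=
  HomologicalComplex.Hom.isoOfComponents (fun n => asIso (symmHom k A n)) (by
    rintro i j rfl
    -- Both differentials are replaced by the maps from which the complexes were built; the square
    -- is then `symm_d` on elements.
    refine (congrArg (symmHom k A i ≫ ·) (CochainComplex.of_d _ _ i)).trans (Eq.trans ?_
      (congrArg (· ≫ symmHom k A (i + 1)) (CochainComplex.of_d _ _ i)).symm)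
    ext s
    exact Subtype.ext (symm_d k A s.1).symm)

end ComplexIso

end LiePair

theorem mainTheorem5 {k R L : Type*} [Field k] [CharZero k] [CommRing R]
    [Algebra k R] [LieRing L] [LieAlgebra k L] [Module R L] [LieRingModule L R]
    [LieRinehartRing R L] [LieRinehartAlgebra k R L] (A : LieRinehartSubalgebra R L) :
    (∃! I : LiePair.Sym k A →ₗ[R] LiePair.Poly k A, LiePair.IsSymmetrization k A I) ∧
    ∀ I : LiePair.Sym k A →ₗ[R] LiePair.Poly k A, LiePair.IsSymmetrization k A I →
      ∃ φ : LiePair.symComplex k A ≅ LiePair.polyComplex k A,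
        ∀ (n : ℕ) (s : LiePair.Sym.deg k A n),
          (LiePair.Poly.deg k A n).subtype (φ.hom.f n s) = I s := by
  refine ⟨⟨LiePair.Sym.symm k A, LiePair.Sym.isSymmetrization_symm k A, fun I hI =>
    hI.eq_symm⟩, fun I hI => ⟨LiePair.Sym.symmIso k A, fun n s => ?_⟩⟩
  -- By uniqueness `I` is `symm`, and the components of `symmIso` are its restrictions by
  -- definition.
  rw [hI.eq_symm]
  rfl
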